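/- Let $d\ge 0$ be an integer and write $\langle z\rangle=\sqrt{1+|z|^2}$, where $|z|$ is the Euclidean norm on $\mathbb R^{2d}$. For $m\in\mathbb R$ let $G_h^m$ be the set of families $a=a(z;h)$, $z\in\mathbb R^{2d}$, $h\in(0,1]$, of complex-valued functions that are $C^\infty$ in $z$ and such that for every $\alpha\in\mathbb N^{2d}$ there is $C_\alpha>0$ with $$|\partial_z^\alpha a(z;h)|\le C_\alpha\, h^{|\alpha|}\langle hz\rangle^{m-|\alpha|},\qquad z\in\mathbb R^{2d},\ h\in(0,1].$$ For a function $b$ on $\mathbb R^{2d}$ put $b_h(z)=b(hz)$. For a smooth $p$ on $\mathbb R^{2d}$ with $|\partial^\alpha p(z)|\lesssim\langle z\rangle^{m-|\alpha|}$ for all $\alpha$ (a Shubin symbol of order $m$), let $$p^w(x,D)u(x)=(2\pi)^{-d}\int_{\mathbb R^d}\int_{\mathbb R^d}e^{i(x-y)\cdot\xi}\,p\big(\tfrac{x+y}2,\xi\big)\,u(y)\,dy\,d\xi,\qquad u\in\mathscr S(\mathbb R^d),$$ be its Weyl quantization (an iterated integral), and let $p\,\#\,q$ be the Weyl product, that is,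 the Shubin symbol (of some order) with $(p\,\#\,q)^w(x,D)=p^w(x,D)\,q^w(x,D)$ on $\mathscr S(\mathbb R^d)$. For families of symbols, $\#$ is taken for each fixed $h\in(0,1]$. Let $a\in G_h^0$, $C>0$ and $R>0$ be such that $|a(z;h)|\ge C$ for all $h\in(0,1]$ and all $z\in\mathbb R^{2d}$ with $h|z|\ge R$. Let $U\subseteq\mathbb R^{2d}$ be relatively compact with $\overline U\cap\overline{B_R}=\emptyset$, where $\overline{B_R}$ is the closed ball of radius $R$ centered at the origin. Then there is $c\in G_h^0$ such that for every $b\in C_c^\infty(U)$ (a smooth complex-valued function on $\mathbb R^{2d}$ with compact support contained in $U$) the Weyl products below exist and $$b_h\,\#\,c\,\#\,a-b_h\in\bigcap_{k\in\mathbb N}h^kG_h^{-k}.$$ Moreover, if $a\in C^\infty(\mathbb R^{2d}\times(0,1])$ jointly in $(z,h)$, then $c$ can be chosen in $C^\infty(\mathbb R^{2d}\times(0,1])$ as well. -/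

import Mathlib

open Set MeasureTheory
open scoped ContDiff SchwartzMap

/-- Configuration space `ℝ^d` with its Euclidean norm. -/
abbrev ConfSpace (d : ℕ) : Type := EuclideanSpace ℝ (Fin d)

/-- Phase space `ℝ^{2d}`, points `z = (x, ξ)`, with its Euclidean norm
`|z|² = |x|² + |ξ|²`. -/
abbrev PhaseSpace (d : ℕ) : Type := WithLp 2 (ConfSpace d × ConfSpace d)

/-- The Japanese bracket `⟨z⟩ = √(1 + |z|²)` on phase space. -/
noncomputable def japaneseBracket {d : ℕ} (z : PhaseSpace d) : ℝ :=
  Real.sqrt (1 + ‖z‖ ^ 2)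

/-- The Shubin class `G^m`: smooth `p : ℝ^{2d} → ℂ` with
`|∂^α p(z)| ≤ C_α ⟨z⟩^{m-|α|}` for all multi-indices `α`. The partial derivatives of order
`n` are controlled together, through the norm of the `n`-th total derivative. -/
def IsShubinSymbol {d : ℕ} (m : ℝ) (p : PhaseSpace d → ℂ) : Prop :=
  ContDiff ℝ ∞ p ∧
    ∀ n : ℕ, ∃ C : ℝ, ∀ z : PhaseSpace d,
      ‖iteratedFDeriv ℝ n p z‖ ≤ C * japaneseBracket z ^ (m - (n : ℝ))

/-- The class `G_h^m` of `h`-Shubin symbols of order `m`: families `a h z = a(z; h)`,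
`h ∈ (0,1]`, of smooth functions of `z ∈ ℝ^{2d}` with
`|∂_z^α a(z; h)| ≤ C_α h^{|α|} ⟨h z⟩^{m-|α|}` for all multi-indices `α`, where `C_α` does not
depend on `z` and `h`. (Values at `h ∉ (0,1]` are irrelevant. Regularity in `h` is treated
separately, see `IsJointlySmooth`.) -/
def hShubinClass (d : ℕ) (m : ℝ) : Set (ℝ → PhaseSpace d → ℂ) :=
  {a | (∀ h ∈ Ioc (0 : ℝ) 1, ContDiff ℝ ∞ (a h)) ∧
    ∀ n : ℕ, ∃ C : ℝ, ∀ h ∈ Ioc (0 : ℝ) 1, ∀ z : PhaseSpace d,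
      ‖iteratedFDeriv ℝ n (a h) z‖ ≤ C * h ^ n * japaneseBracket (h • z) ^ (m - (n : ℝ))}

/-- The family belongs to `C^∞(ℝ^{2d} × (0,1])` jointly in `(z, h)` (with one-sided
derivatives in `h` at `h = 1`). -/
def IsJointlySmooth {d : ℕ} (a : ℝ → PhaseSpace d → ℂ) : Prop :=
  ContDiffOn ℝ ∞ (fun q : ℝ × PhaseSpace d => a q.1 q.2) (Ioc (0 : ℝ) 1 ×ˢ univ)

/-- The class `⋂_{k ∈ ℕ} h^k G_h^{-k}`. -/
def hNegligible (d : ℕ) : Set (ℝ → PhaseSpace d → ℂ) :=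
  {r | ∀ k : ℕ, ∃ g ∈ hShubinClass d (-(k : ℝ)),
    ∀ h ∈ Ioc (0 : ℝ) 1, ∀ z : PhaseSpace d, r h z = (h : ℂ) ^ k * g h z}

/-- The dilated symbol `b_h(z) = b(h z)`. -/
def dilate {d : ℕ} (b : PhaseSpace d → ℂ) (h : ℝ) (z : PhaseSpace d) : ℂ := b (h • z)

/-- Weyl quantization
`p^w(x,D) u(x) = (2π)^{-d} ∫ (∫ e^{i (x-y)·ξ} p((x+y)/2, ξ) u(y) dy) dξ`.
For `p` in a Shubin class and `u` a Schwartz function the inner integral converges absolutely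
and, by integration by parts in `y`, decreases rapidly in `ξ`, so the outer one converges
absolutely as well; its value is the limit as `ε → 0+` of the integrals with an additional
cut-off factor `ψ(ε ξ)`, where `ψ` is a test function equal to one near the origin. -/
noncomputable def weylOp {d : ℕ} (p : PhaseSpace d → ℂ) (u : ConfSpace d → ℂ)
    (x : ConfSpace d) : ℂ :=
  (((2 * Real.pi) ^ d : ℝ) : ℂ)⁻¹ *
    ∫ ξ : ConfSpace d, ∫ y : ConfSpace d,
      Complex.exp (Complex.I * ((inner ℝ (x - y) ξ : ℝ) : ℂ)) *
        p (WithLp.toLp 2 ((1 / 2 : ℝ) • (x + y), ξ)) * u y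

/-- `s = p # q`: the Weyl product of `p` and `q` is the Shubin symbol `s` (of some order) with
`s^w(x,D) = p^w(x,D) q^w(x,D)` on Schwartz functions. -/
def IsWeylProduct {d : ℕ} (p q s : PhaseSpace d → ℂ) : Prop :=
  (∃ m : ℝ, IsShubinSymbol m s) ∧
    ∀ (u : 𝓢(ConfSpace d, ℂ)) (x : ConfSpace d),
      weylOp s (fun y => u y) x = weylOp p (weylOp q (fun y => u y)) x

/-! Substitute `w = h z`. A symbol in `G_h^0` becomes a family `A(w; h) = a(w / h; h)` all of whose
`w`-derivatives are bounded uniformly in `h`, and the Weyl product of two dilated symbols becomes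
the dilation of the product `twist` with parameter `τ = h²`, namely `∫ e^{2πi⟨ζ,w⟩} 𝓕B(ζ) Q(w +
τπJζ) dζ` (`twist_comp_smul`). For `B` Schwartz and `Q` smooth with bounded derivatives this
integral converges absolutely, so no oscillatory integrals are needed. This case suffices: `b` has
compact support, and `c` may be taken Schwartz in `w`, since `a` has to be inverted only near `U`.
That `twist` with `τ = 1` is the symbol of the composed operators is `WeylAdmissible.weylOp_twist`.

Differentiating `twist` in `τ` gives twisted products of derivatives of the factors. Its Taylor
expansion at `τ = 0` is therefore the Moyal expansion, and the remainder after `N` terms is `O(τ^N)`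
in every Schwartz seminorm (`SchwartzO.moyalRem`).

By ellipticity, `E = χ · G(A)`, with `G(z) = 1/z` for `|z| ≥ C` and `χ` a cutoff, inverts `A` on an
open set `O` containing `U`. Starting from `E`, coefficients `c_n` are defined recursively so that
on `O` the formal Moyal product of `∑ τ^n c_n` with `A` is `1`; `exists_borelSum` produces a family
`c` with this expansion. Moyal terms are local and `b` is supported in `O`, so the expansion of `b #
(c # A)` reduces to `b` (`SchwartzO.twist_twist_sub`). The difference is `O(h^{2N})` in Schwartz
seminorms for every `N`, and dilating back yields an element of `h^k G_h^{-k}` for every `k`. Joint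
smoothness survives because the `c_n` are built from `a` by smooth operations and derivatives, and
the Borel sum is locally finite in `h`. -/

/-! ### Families of smooth functions with uniform bounds -/

section Families

open scoped FourierTransform

variable {ι κ V : Type*} [NormedAddCommGroup V] [InnerProductSpace ℝ V]

/-- A family of smooth functions all of whose derivatives, multiplied by `‖w‖ ^ k`, are
bounded by a constant times the weight `θ` of the index. -/
def WeightedBound (k : ℕ) (θ : ι → ℝ) (B : ι → V → ℂ) : Prop :=
  (∀ i, ContDiff ℝ ∞ (B i)) ∧
    ∀ n : ℕ, ∃ C : ℝ, 0 ≤ C ∧ ∀ i w, ‖w‖ ^ k * ‖iteratedFDeriv ℝ n (B i) w‖ ≤ C * θ i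

/-- A family of Schwartz functions whose seminorms are `O(θ)`. -/
def SchwartzO (θ : ι → ℝ) (B : ι → V → ℂ) : Prop := ∀ k, WeightedBound k θ B

/-- A family of smooth functions whose derivatives are `O(θ)` uniformly on the whole space. -/
def SmoothO (θ : ι → ℝ) (B : ι → V → ℂ) : Prop := WeightedBound 0 θ B

/-- The derivative of `f` in the direction `v`. -/
noncomputable def dirDeriv (v : V) (f : V → ℂ) (w : V) : ℂ := fderiv ℝ f w v

variable {k : ℕ} {θ η : ι → ℝ} {B Q : ι → V → ℂ}

lemma SchwartzO.smoothO (h : SchwartzO θ B) : SmoothO θ B := h 0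

lemma SchwartzO.contDiff (h : SchwartzO θ B) (i : ι) : ContDiff ℝ ∞ (B i) := (h 0).1 i

lemma SmoothO.contDiff (h : SmoothO θ B) (i : ι) : ContDiff ℝ ∞ (B i) := h.1 i

lemma WeightedBound.comp_index (h : WeightedBound k θ B) (g : κ → ι) :
    WeightedBound k (fun j => θ (g j)) (fun j => B (g j)) :=
  ⟨fun _ => h.1 _, fun n => (h.2 n).imp fun _ hC => ⟨hC.1, fun _ => hC.2 _⟩⟩

lemma SchwartzO.comp_index (h : SchwartzO θ B) (g : κ → ι) :
    SchwartzO (fun j => θ (g j)) (fun j => B (g j)) := fun k => (h k).comp_index g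

lemma SmoothO.comp_index (h : SmoothO θ B) (g : κ → ι) :
    SmoothO (fun j => θ (g j)) (fun j => B (g j)) := WeightedBound.comp_index h g

lemma WeightedBound.mono (h : WeightedBound k θ B) {M : ℝ} (h0 : 0 ≤ M)
    (hM : ∀ i, θ i ≤ M * η i) : WeightedBound k η B := by
  refine ⟨h.1, fun n => ?_⟩
  obtain ⟨C, hC0, hC⟩ := h.2 n
  refine ⟨C * M, by positivity, fun i w => (hC i w).trans ?_⟩
  rw [mul_assoc]
  exact mul_le_mul_of_nonneg_left (hM i) hC0

lemma SchwartzO.mono (h : SchwartzO θ B) {M : ℝ} (h0 : 0 ≤ M)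
    (hM : ∀ i, θ i ≤ M * η i) : SchwartzO η B := fun k => (h k).mono h0 hM

lemma WeightedBound.add (hB : WeightedBound k θ B) (hQ : WeightedBound k θ Q) :
    WeightedBound k θ (fun i w => B i w + Q i w) := by
  refine ⟨fun i => (hB.1 i).add (hQ.1 i), fun n => ?_⟩
  obtain ⟨C, hC0, hC⟩ := hB.2 n
  obtain ⟨D, hD0, hD⟩ := hQ.2 n
  refine ⟨C + D, by positivity, fun i w => ?_⟩
  have : iteratedFDeriv ℝ n (fun w => B i w + Q i w) w
      = iteratedFDeriv ℝ n (B i) w + iteratedFDeriv ℝ n (Q i) w :=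
    iteratedFDeriv_add_apply ((hB.1 i).of_le (mod_cast le_top)).contDiffAt
      ((hQ.1 i).of_le (mod_cast le_top)).contDiffAt
  rw [this]
  calc _ ≤ ‖w‖ ^ k * (‖iteratedFDeriv ℝ n (B i) w‖ + ‖iteratedFDeriv ℝ n (Q i) w‖) := by
        gcongr; exact norm_add_le _ _
    _ ≤ _ := by linarith [hC i w, hD i w]

lemma WeightedBound.mul (hB : WeightedBound k θ B) (hQ : SmoothO η Q) :
    WeightedBound k (fun i => θ i * η i) (fun i w => B i w * Q i w) := by
  refine ⟨fun i => (hB.1 i).mul (hQ.1 i), fun n => ?_⟩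
  choose C hC0 hC using hB.2
  choose D hD0 hD using hQ.2
  refine ⟨∑ j ∈ Finset.range (n + 1), n.choose j * C j * D (n - j),
    Finset.sum_nonneg fun j _ => mul_nonneg (mul_nonneg (by positivity) (hC0 j)) (hD0 _),
    fun i w => ?_⟩
  have h1 := norm_iteratedFDeriv_mul_le (𝕜 := ℝ) (hB.1 i) (hQ.1 i) w (n := n) (mod_cast le_top)
  refine (mul_le_mul_of_nonneg_left h1 (by positivity)).trans ?_
  rw [Finset.mul_sum, Finset.sum_mul]
  refine Finset.sum_le_sum fun j _ => ?_
  have h2 := hD (n - j) i w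
  rw [pow_zero, one_mul] at h2
  have h3 := mul_le_mul (hC j i w) h2 (norm_nonneg _)
    ((by positivity : (0 : ℝ) ≤ ‖w‖ ^ k * ‖iteratedFDeriv ℝ j (B i) w‖).trans (hC j i w))
  have h4 := mul_le_mul_of_nonneg_left h3 (Nat.cast_nonneg (α := ℝ) (n.choose j))
  linarith

lemma SchwartzO.mul (hB : SchwartzO θ B) (hQ : SmoothO η Q) :
    SchwartzO (fun i => θ i * η i) (fun i w => B i w * Q i w) := fun k => (hB k).mul hQ

lemma SchwartzO.add (hB : SchwartzO θ B) (hQ : SchwartzO θ Q) :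
    SchwartzO θ (fun i w => B i w + Q i w) := fun k => (hB k).add (hQ k)

lemma SmoothO.const {c : ι → ℂ} (hc : ∀ i, ‖c i‖ ≤ θ i) :
    SmoothO θ (fun i (_ : V) => c i) := by
  refine ⟨fun i => contDiff_const, fun n => ⟨1, zero_le_one, fun i w => ?_⟩⟩
  rcases Nat.eq_zero_or_pos n with rfl | hn
  · simpa using hc i
  · rw [iteratedFDeriv_const_of_ne hn.ne']
    simpa using (norm_nonneg _).trans (hc i)

lemma WeightedBound.const_mul (hB : WeightedBound k θ B) {c : ι → ℂ} (hc : ∀ i, ‖c i‖ ≤ η i) :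
    WeightedBound k (fun i => θ i * η i) (fun i w => c i * B i w) := by
  simpa only [mul_comm (c _)] using hB.mul (SmoothO.const hc)

lemma SchwartzO.const_mul (hB : SchwartzO θ B) {c : ι → ℂ} (hc : ∀ i, ‖c i‖ ≤ η i) :
    SchwartzO (fun i => θ i * η i) (fun i w => c i * B i w) := fun k => (hB k).const_mul hc

lemma WeightedBound.const_mul' (hB : WeightedBound k θ B) (c : ℂ) :
    WeightedBound k θ (fun i w => c * B i w) :=
  (hB.const_mul (η := fun _ => ‖c‖) (c := fun _ => c) fun _ => le_rfl).mono (norm_nonneg c)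
    fun i => by rw [mul_comm]

lemma SchwartzO.const_mul' (hB : SchwartzO θ B) (c : ℂ) :
    SchwartzO θ (fun i w => c * B i w) := fun k => (hB k).const_mul' c

lemma WeightedBound.sub (hB : WeightedBound k θ B) (hQ : WeightedBound k θ Q) :
    WeightedBound k θ (fun i w => B i w - Q i w) := by
  simpa [sub_eq_add_neg] using hB.add (hQ.const_mul' (-1))

lemma SchwartzO.sub (hB : SchwartzO θ B) (hQ : SchwartzO θ Q) :
    SchwartzO θ (fun i w => B i w - Q i w) := fun k => (hB k).sub (hQ k)

lemma WeightedBound.zero : WeightedBound k θ (fun _ (_ : V) => 0) := by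
  refine ⟨fun i => contDiff_const, fun n => ⟨0, le_rfl, fun i w => ?_⟩⟩
  have : iteratedFDeriv ℝ n (fun _ : V => (0 : ℂ)) w = 0 := by
    rw [show (fun _ : V => (0 : ℂ)) = 0 from rfl, iteratedFDeriv_zero]; rfl
  rw [this]; simp

lemma WeightedBound.sum {F : κ → ι → V → ℂ} (s : Finset κ)
    (h : ∀ j ∈ s, WeightedBound k θ (F j)) :
    WeightedBound k θ (fun i w => ∑ j ∈ s, F j i w) := by
  classical
  induction s using Finset.induction_on with
  | empty => simpa using WeightedBound.zero
  | insert a s ha ih =>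
    simp only [Finset.sum_insert ha]
    exact (h a (by simp)).add (ih fun j hj => h j (by simp [hj]))

lemma SchwartzO.sum {F : κ → ι → V → ℂ} (s : Finset κ)
    (h : ∀ j ∈ s, SchwartzO θ (F j)) :
    SchwartzO θ (fun i w => ∑ j ∈ s, F j i w) :=
  fun k => WeightedBound.sum s fun j hj => h j hj k

protected lemma ContDiff.dirDeriv {f : V → ℂ} (hf : ContDiff ℝ ∞ f) (v : V) :
    ContDiff ℝ ∞ (dirDeriv v f) :=
  (hf.fderiv_right (m := ∞) (by simp)).clm_apply contDiff_const

lemma norm_iteratedFDeriv_dirDeriv_le {f : V → ℂ} (hf : ContDiff ℝ ∞ f) (v : V) (n : ℕ) (w : V) :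
    ‖iteratedFDeriv ℝ n (dirDeriv v f) w‖ ≤ ‖v‖ * ‖iteratedFDeriv ℝ (n + 1) f w‖ := by
  have h := norm_iteratedFDeriv_clm_apply_const (𝕜 := ℝ) (f := fderiv ℝ f) (c := v) (x := w)
    (N := ∞) (n := n) (hf.fderiv_right (m := ∞) (by simp)).contDiffAt (mod_cast le_top)
  rwa [norm_iteratedFDeriv_fderiv] at h

protected lemma WeightedBound.dirDeriv (hB : WeightedBound k θ B) (v : V) :
    WeightedBound k θ (fun i => dirDeriv v (B i)) := by
  refine ⟨fun i => (hB.1 i).dirDeriv v, fun n => ?_⟩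
  obtain ⟨C, hC0, hC⟩ := hB.2 (n + 1)
  refine ⟨‖v‖ * C, by positivity, fun i w => ?_⟩
  have := mul_le_mul_of_nonneg_left (norm_iteratedFDeriv_dirDeriv_le (hB.1 i) v n w)
    (by positivity : (0 : ℝ) ≤ ‖w‖ ^ k)
  have h2 := mul_le_mul_of_nonneg_left (hC i w) (norm_nonneg v)
  linarith

protected lemma SchwartzO.dirDeriv (hB : SchwartzO θ B) (v : V) :
    SchwartzO θ (fun i => dirDeriv v (B i)) := fun k => (hB k).dirDeriv v

protected lemma SmoothO.dirDeriv (hB : SmoothO θ B) (v : V) :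
    SmoothO θ (fun i => dirDeriv v (B i)) := WeightedBound.dirDeriv hB v

/-- Composition of a family of bounded smooth functions with a bounded family of linear maps,
followed by arbitrary translations. -/
lemma SmoothO.comp_affine {W : Type*} [NormedAddCommGroup W] [InnerProductSpace ℝ W]
    (hQ : SmoothO θ Q) (p : ι → V) (L : ι → W →L[ℝ] V) {M : ℝ} (hL : ∀ i, ‖L i‖ ≤ M) :
    SmoothO θ (fun i ζ => Q i (p i + L i ζ)) := by
  refine ⟨fun i => (hQ.1 i).comp (contDiff_const.add (L i).contDiff), fun n => ?_⟩
  obtain ⟨C, hC0, hC⟩ := hQ.2 n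
  refine ⟨C * |M| ^ n, by positivity, fun i w => ?_⟩
  have h1 : ContDiff ℝ ∞ (fun z => Q i (p i + z)) := (hQ.1 i).comp (contDiff_const.add contDiff_id)
  have h2 := (L i).iteratedFDeriv_comp_right h1 w (i := n) (mod_cast le_top)
  rw [iteratedFDeriv_comp_add_left] at h2
  have h2' : iteratedFDeriv ℝ n (fun ζ => Q i (p i + L i ζ)) w = _ := h2
  rw [h2', pow_zero, one_mul]
  refine (ContinuousMultilinearMap.norm_compContinuousLinearMap_le _ _).trans ?_
  simp only [Finset.prod_const, Finset.card_univ, Fintype.card_fin]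
  have h3 := hC i (p i + L i w)
  rw [pow_zero, one_mul] at h3
  have h4 : ‖L i‖ ^ n ≤ |M| ^ n :=
    pow_le_pow_left₀ (norm_nonneg _) ((hL i).trans (le_abs_self M)) n
  calc _ ≤ (C * θ i) * |M| ^ n :=
        mul_le_mul h3 h4 (by positivity) ((norm_nonneg _).trans h3)
    _ = _ := by ring

/-- The members of a `SchwartzO` family as Schwartz functions. -/
noncomputable def SchwartzO.toSchwartz (hB : SchwartzO θ B) (i : ι) : 𝓢(V, ℂ) where
  toFun := B i
  smooth' := (hB 0).1 i
  decay' k n := by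
    obtain ⟨C, -, hC⟩ := (hB k).2 n
    exact ⟨C * θ i, hC i⟩

@[simp] lemma SchwartzO.coe_toSchwartz (hB : SchwartzO θ B) (i : ι) :
    (hB.toSchwartz i : V → ℂ) = B i := rfl

lemma SchwartzMap.schwartzO (f : 𝓢(V, ℂ)) : SchwartzO (fun _ : ι => 1) (fun _ => f) := by
  refine fun k => ⟨fun _ => f.smooth ⊤, fun n => ?_⟩
  obtain ⟨C, hC⟩ := f.decay k n
  exact ⟨C, hC.1.le, fun i w => by simpa using hC.2 w⟩

/-- Each seminorm of `T f` is dominated by finitely many seminorms of `f`, so uniform bounds are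
transported. The Fourier transform and its inverse are the cases of interest. -/
lemma SchwartzO.of_continuous_map {W : Type*} [NormedAddCommGroup W] [InnerProductSpace ℝ W]
    (T : 𝓢(V, ℂ) →L[ℝ] 𝓢(W, ℂ)) (hB : SchwartzO θ B) :
    SchwartzO θ (fun i => (T (hB.toSchwartz i) : W → ℂ)) := by
  refine fun k => ⟨fun i => (T _).smooth ⊤, fun n => ?_⟩
  let q : Seminorm ℝ 𝓢(V, ℂ) := (SchwartzMap.seminorm ℝ k n).comp T.toLinearMap
  have hq : Continuous q :=
    ((schwartz_withSeminorms ℝ W ℂ).continuous_seminorm (k, n)).comp T.continuous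
  obtain ⟨s, C, -, hC⟩ := Seminorm.bound_of_continuous (schwartz_withSeminorms ℝ V ℂ) q hq
  choose D hD0 hD using fun (m : ℕ × ℕ) => (hB m.1).2 m.2
  refine ⟨C * ∑ m ∈ s, D m, mul_nonneg C.2 (Finset.sum_nonneg fun m _ => hD0 m), fun i w => ?_⟩
  have h1 : ‖w‖ ^ k * ‖iteratedFDeriv ℝ n (T (hB.toSchwartz i)) w‖ ≤ q (hB.toSchwartz i) :=
    SchwartzMap.le_seminorm ℝ k n (T (hB.toSchwartz i)) w
  refine h1.trans ((hC _).trans ?_)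
  -- Weights are not assumed nonnegative. A negative `θ i` forces `B i` and all the constants `D m`
  -- to vanish, and both sides are zero.
  rcases lt_or_ge (θ i) 0 with hθ | hθ
  · have hz : hB.toSchwartz i = 0 := by
      ext w
      have := hD (0, 0) i w
      have h3 : ‖B i w‖ ≤ D (0, 0) * θ i := by simpa using this
      have h4 : D (0, 0) * θ i ≤ 0 := mul_nonpos_of_nonneg_of_nonpos (hD0 _) hθ.le
      simpa using norm_le_zero_iff.mp (h3.trans h4)
    have h5 : C * (∑ m ∈ s, D m) * θ i = 0 := by
      have : ∀ m, D m = 0 ∨ 0 < D m := fun m => (hD0 m).eq_or_lt.imp Eq.symm id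
      have : ∀ m ∈ s, D m = 0 := fun m _ => by
        rcases this m with h | h
        · exact h
        · have h6 := hD m i 0
          have h7 : (0 : ℝ) ≤ D m * θ i := (by positivity : (0 : ℝ) ≤ _).trans h6
          nlinarith
      rw [Finset.sum_eq_zero this]; simp
    rw [h5, hz]; simp
  · have h2 : s.sup (schwartzSeminormFamily ℝ V ℂ) (hB.toSchwartz i) ≤ ∑ m ∈ s, D m * θ i := by
      refine Seminorm.finset_sup_apply_le
        (Finset.sum_nonneg fun m _ => mul_nonneg (hD0 m) hθ) fun m hm => ?_
      refine le_trans ?_ (Finset.single_le_sum (f := fun m => D m * θ i)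
        (fun m _ => mul_nonneg (hD0 m) hθ) hm)
      exact SchwartzMap.seminorm_le_bound ℝ _ _ _ (mul_nonneg (hD0 m) hθ) fun w => hD m i w
    rw [← Finset.sum_mul] at h2
    rw [mul_assoc]
    exact mul_le_mul_of_nonneg_left h2 C.2

variable [FiniteDimensional ℝ V] [MeasurableSpace V] [BorelSpace V]

protected lemma SchwartzO.fourier (hB : SchwartzO θ B) : SchwartzO θ (fun i => 𝓕 (B i)) :=
  hB.of_continuous_map (FourierTransform.fourierCLM ℝ 𝓢(V, ℂ))

protected lemma SchwartzO.fourierInv (hB : SchwartzO θ B) : SchwartzO θ (fun i => 𝓕⁻ (B i)) := by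
  have := hB.of_continuous_map (FourierTransform.fourierInvCLM ℝ 𝓢(V, ℂ))
  convert this using 2 with i
  exact (SchwartzMap.fourierInv_coe (hB.toSchwartz i)).symm

end Families

/-! ### The twisted product and its asymptotic expansion -/

section Twist

open scoped FourierTransform RealInnerProductSpace

variable {ι V : Type*} [NormedAddCommGroup V] [InnerProductSpace ℝ V]
  [FiniteDimensional ℝ V] {θ η : ι → ℝ} {B Q : ι → V → ℂ}

lemma fderiv_eq_sum_dirDeriv (f : V → ℂ) (w : V) :
    fderiv ℝ f w = ∑ i, (innerSL ℝ (stdOrthonormalBasis ℝ V i)).smulRight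
      (dirDeriv (stdOrthonormalBasis ℝ V i) f w) := by
  ext v
  conv_lhs => rw [← (stdOrthonormalBasis ℝ V).sum_repr' v]
  simp [dirDeriv]

lemma contDiff_succ_of_dirDeriv {f : V → ℂ} {n : ℕ} (hf : Differentiable ℝ f)
    (h : ∀ i, ContDiff ℝ n (dirDeriv (stdOrthonormalBasis ℝ V i) f)) :
    ContDiff ℝ (n + 1 : ℕ) f := by
  rw [Nat.cast_add, Nat.cast_one, contDiff_succ_iff_fderiv]
  refine ⟨hf, by simp, ?_⟩
  rw [show fderiv ℝ f = fun w => _ from funext (fderiv_eq_sum_dirDeriv f)]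
  exact ContDiff.sum fun i _ => contDiff_const.smulRight (h i)

/-- Reduces bounds on total derivatives to an induction through directional ones, for which the
twisted product satisfies a Leibniz rule. -/
lemma norm_iteratedFDeriv_succ_le_sum_dirDeriv {f : V → ℂ} (hf : ContDiff ℝ ∞ f) (n : ℕ) (w : V) :
    ‖iteratedFDeriv ℝ (n + 1) f w‖ ≤
      ∑ i, ‖iteratedFDeriv ℝ n (dirDeriv (stdOrthonormalBasis ℝ V i) f) w‖ := by
  rw [← norm_iteratedFDeriv_fderiv,
    show fderiv ℝ f = fun w => _ from
      funext (fderiv_eq_sum_dirDeriv f)]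
  have hsm : ∀ i, ContDiff ℝ ∞ (fun w => (innerSL ℝ (stdOrthonormalBasis ℝ V i)).smulRight
      (dirDeriv (stdOrthonormalBasis ℝ V i) f w)) := fun i =>
    contDiff_const.smulRight (hf.dirDeriv _)
  rw [iteratedFDeriv_fun_sum_apply fun i _ => ((hsm i).of_le (mod_cast le_top)).contDiffAt]
  refine (norm_sum_le _ _).trans (Finset.sum_le_sum fun i _ => ?_)
  have := ContinuousLinearMap.norm_iteratedFDeriv_comp_left
    (ContinuousLinearMap.smulRightL ℝ V ℂ (innerSL ℝ (stdOrthonormalBasis ℝ V i)))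
    (f := dirDeriv (stdOrthonormalBasis ℝ V i) f) (x := w) (N := ∞) (n := n)
    (hf.dirDeriv _).contDiffAt (mod_cast le_top)
  refine this.trans (mul_le_of_le_one_left (norm_nonneg _) ?_)
  refine ContinuousLinearMap.opNorm_le_bound _ zero_le_one fun c => ?_
  simp [ContinuousLinearMap.smulRightL, ContinuousLinearMap.norm_smulRight_apply]

variable [MeasurableSpace V] [BorelSpace V]

/-- The twisted product of `B` and `Q` with parameter `τ`. For the standard symplectic map `J`
and `τ = 1` this is the Weyl product. -/
noncomputable def twist (J : V →L[ℝ] V) (τ : ℝ) (B Q : V → ℂ) (w : V) : ℂ :=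
  𝓕⁻ (fun ζ => 𝓕 B ζ * Q (w + (τ * Real.pi) • J ζ)) w

variable (J : V →L[ℝ] V)

/-- The base point is frozen and made part of the index: for each `(i, w)` the integrand is a
Schwartz function of `ζ`, with seminorms uniform in `w` because `Q` has uniform bounds. Its inverse
Fourier transform decays rapidly, in particular at the point `w` itself. -/
lemma twist_pow_bound (hB : SchwartzO θ B) (hQ : SmoothO η Q) {τ : ι → ℝ} (hτ : ∀ i, |τ i| ≤ 1)
    (k : ℕ) :
    ∃ C, 0 ≤ C ∧ ∀ i w, ‖w‖ ^ k * ‖twist J (τ i) (B i) (Q i) w‖ ≤ C * (θ i * η i) := by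
  have h1 := (hB.fourier.comp_index (Prod.fst : ι × V → ι)).mul
    ((hQ.comp_index (Prod.fst : ι × V → ι)).comp_affine Prod.snd
      (fun j => (τ j.1 * Real.pi) • J) (M := Real.pi * ‖J‖) (fun j => by
        rw [norm_smul, Real.norm_eq_abs, abs_mul, abs_of_pos Real.pi_pos]
        have := mul_le_mul_of_nonneg_right (hτ j.1) (by positivity : 0 ≤ Real.pi * ‖J‖)
        linarith))
  obtain ⟨C, hC0, hC⟩ := (h1.fourierInv k).2 0
  exact ⟨C, hC0, fun i w => by simpa [twist] using hC (i, w) w⟩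

lemma dirDeriv_fourier_schwartz (B : 𝓢(V, ℂ)) (v ζ : V) :
    𝓕 (dirDeriv v B) ζ = 2 * Real.pi * Complex.I * ⟪ζ, v⟫ * 𝓕 (B : V → ℂ) ζ := by
  have h := congrArg (fun f : 𝓢(V, ℂ) => f ζ) (SchwartzMap.fourier_lineDerivOp_eq B v)
  have : (inner ℝ · v : V → ℝ).HasTemperateGrowth := ((innerSL ℝ).flip v).hasTemperateGrowth
  simp only [smul_apply, SchwartzMap.smulLeftCLM_apply_apply this,
    SchwartzMap.fourier_coe] at h
  have h2 : (LineDeriv.lineDerivOp v B : V → ℂ) = dirDeriv v B := by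
    ext w; simp [dirDeriv, SchwartzMap.lineDerivOp_apply_eq_fderiv]
  rw [h2] at h
  rw [h]; simp; ring


lemma twist_eq_integral (τ : ℝ) (B Q : V → ℂ) (w : V) :
    twist J τ B Q w = ∫ ζ, Complex.exp (2 * Real.pi * ⟪ζ, w⟫ * Complex.I) *
      (𝓕 B ζ * Q (w + (τ * Real.pi) • J ζ)) := by
  rw [twist, Real.fourierInv_eq']
  simp

lemma norm_cexp_two_pi (x : ℝ) : ‖Complex.exp (2 * Real.pi * x * Complex.I)‖ = 1 := by
  have := Complex.norm_exp_ofReal_mul_I (2 * Real.pi * x)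
  push_cast at this
  exact this

variable {P : Type*} [NormedAddCommGroup P] [NormedSpace ℝ P] (α : P →L[ℝ] V) (β : P →L[ℝ] ℝ)
  (w : V) (τ : ℝ)

/-- The derivative of the integrand of the twisted product with respect to the base point and to
the parameter. -/
noncomputable def twistIntegrandDeriv (B Q : V → ℂ) (p : P) (ζ : V) : P →L[ℝ] ℂ :=
  (Complex.exp (2 * Real.pi * ⟪ζ, w + α p⟫ * Complex.I) * 𝓕 B ζ) •
    ((2 * Real.pi * Complex.I * Q ((w + α p) + ((τ + β p) * Real.pi) • J ζ)) •
        (Complex.ofRealCLM.comp ((innerSL ℝ ζ).comp α)) +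
      (fderiv ℝ Q ((w + α p) + ((τ + β p) * Real.pi) • J ζ)).comp
        (α +
          β.smulRight (Real.pi • J ζ)))

lemma twistIntegrandDeriv_norm_le {Q : V → ℂ} {M₀ M₁ : ℝ} (h0 : ∀ w, ‖Q w‖ ≤ M₀)
    (h1 : ∀ w, ‖fderiv ℝ Q w‖ ≤ M₁)
    (hα : ∀ q, ‖α q‖ ≤ ‖q‖) (hβ : ∀ q, ‖β q‖ ≤ ‖q‖) (B : V → ℂ) (p : P) (ζ : V) :
    ‖twistIntegrandDeriv J α β w τ B Q p ζ‖ ≤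
      (2 * Real.pi * M₀ + M₁ * Real.pi * ‖J‖) * (‖ζ‖ * ‖𝓕 B ζ‖) + M₁ * ‖𝓕 B ζ‖ := by
  have hM0 : 0 ≤ M₀ := (norm_nonneg _).trans (h0 0)
  have hM1 : 0 ≤ M₁ := (norm_nonneg _).trans (h1 0)
  have hpi := Real.pi_pos
  have hJ : ‖J ζ‖ ≤ ‖J‖ * ‖ζ‖ := J.le_opNorm ζ
  refine ContinuousLinearMap.opNorm_le_bound _ (by positivity) fun q => ?_
  have hq1 : ‖α q‖ ≤ ‖q‖ := hα q
  have hq2 : ‖β q‖ ≤ ‖q‖ := hβ q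
  have e1 : ‖(2 * Real.pi * Complex.I * Q ((w + α p) + ((τ + β p) * Real.pi) • J ζ)) * (⟪ζ, α q⟫ : ℂ)‖ ≤
      2 * Real.pi * M₀ * (‖ζ‖ * ‖q‖) := by
    rw [norm_mul]
    have : ‖(⟪ζ, α q⟫ : ℂ)‖ ≤ ‖ζ‖ * ‖q‖ := by
      rw [Complex.norm_real]
      exact (norm_inner_le_norm _ _).trans (by gcongr)
    have h2 : ‖2 * Real.pi * Complex.I * Q ((w + α p) + ((τ + β p) * Real.pi) • J ζ)‖ ≤ 2 * Real.pi * M₀ := by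
      simp only [norm_mul, Complex.norm_ofNat, Complex.norm_real, Complex.norm_I, mul_one,
        Real.norm_of_nonneg hpi.le]
      gcongr; exact h0 _
    gcongr
  have e2 : ‖fderiv ℝ Q ((w + α p) + ((τ + β p) * Real.pi) • J ζ) (α q + β q • Real.pi • J ζ)‖ ≤
      M₁ * (‖q‖ + ‖q‖ * (Real.pi * (‖J‖ * ‖ζ‖))) := by
    refine (ContinuousLinearMap.le_opNorm _ _).trans ?_
    gcongr
    · exact h1 _
    · refine (norm_add_le _ _).trans ?_
      rw [norm_smul, norm_smul, Real.norm_of_nonneg hpi.le]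
      gcongr
  have e3 : ‖twistIntegrandDeriv J α β w τ B Q p ζ q‖ =
      ‖𝓕 B ζ‖ * ‖(2 * Real.pi * Complex.I * Q ((w + α p) + ((τ + β p) * Real.pi) • J ζ)) * (⟪ζ, α q⟫ : ℂ) +
        fderiv ℝ Q ((w + α p) + ((τ + β p) * Real.pi) • J ζ) (α q + β q • Real.pi • J ζ)‖ := by
    simp only [twistIntegrandDeriv, smul_apply, smul_eq_mul, norm_mul,
      norm_cexp_two_pi, one_mul]
    rfl
  rw [e3]
  calc _ ≤ ‖𝓕 B ζ‖ * (2 * Real.pi * M₀ * (‖ζ‖ * ‖q‖) +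
        M₁ * (‖q‖ + ‖q‖ * (Real.pi * (‖J‖ * ‖ζ‖)))) := by
        gcongr; exact (norm_add_le _ _).trans (add_le_add e1 e2)
    _ = _ := by ring

lemma hasFDerivAt_twistIntegrand {Q : V → ℂ} (hQ : ContDiff ℝ ∞ Q) (B : V → ℂ) (p : P)
    (ζ : V) :
    HasFDerivAt (fun p : P => Complex.exp (2 * Real.pi * ⟪ζ, w + α p⟫ * Complex.I) *
      (𝓕 B ζ * Q ((w + α p) + ((τ + β p) * Real.pi) • J ζ))) (twistIntegrandDeriv J α β w τ B Q p ζ) p := by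
  have hin : HasFDerivAt (fun p : P => (⟪ζ, w + α p⟫ : ℂ))
      (Complex.ofRealCLM.comp ((innerSL ℝ ζ).comp α)) p :=
    (Complex.ofRealCLM.comp (innerSL ℝ ζ)).hasFDerivAt.comp p (α.hasFDerivAt.const_add w)
  have hex := ((hin.const_mul (2 * Real.pi : ℂ)).mul_const Complex.I).cexp
  have haff : HasFDerivAt (fun p : P => (w + α p) + ((τ + β p) * Real.pi) • J ζ)
      (α + β.smulRight (Real.pi • J ζ))
      p := by
    refine ((α.hasFDerivAt (x := p)).const_add w).add ?_
    have := ((β.hasFDerivAt (x := p)).const_add τ).smul_const (Real.pi • J ζ)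
    simpa only [mul_smul] using this
  have hQd : HasFDerivAt Q (fderiv ℝ Q ((w + α p) + ((τ + β p) * Real.pi) • J ζ))
    ((w + α p) + ((τ + β p) * Real.pi) • J ζ) := (hQ.differentiable (by simp) _).hasFDerivAt
  have h := hex.mul ((hQd.comp p haff).const_mul (𝓕 B ζ))
  refine h.congr_fderiv ?_
  ext q
  all_goals
    simp [twistIntegrandDeriv]
    ring

/-- Differentiation under the integral sign, dominated by a multiple of `(1 + ‖ζ‖) ‖𝓕 B ζ‖`. The
abstract parameter space `P` serves two purposes: `α = id`, `β = 0` differentiates in the base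
point, and `α = 0`, `β = id` in `τ`. -/
lemma hasFDerivAt_twist (B : 𝓢(V, ℂ)) {Q : V → ℂ} (hQ : ContDiff ℝ ∞ Q) {M₀ M₁ : ℝ}
    (h0 : ∀ w, ‖Q w‖ ≤ M₀) (h1 : ∀ w, ‖fderiv ℝ Q w‖ ≤ M₁)
    (hα : ∀ q, ‖α q‖ ≤ ‖q‖) (hβ : ∀ q, ‖β q‖ ≤ ‖q‖) (p : P) :
    Integrable (twistIntegrandDeriv J α β w τ B Q p) ∧
    HasFDerivAt (fun p : P => twist J (τ + β p) B Q (w + α p)) (∫ ζ, twistIntegrandDeriv J α β w τ B Q p ζ) p := by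
  have hF : ∀ ζ, 𝓕 (B : V → ℂ) ζ = (𝓕 B : 𝓢(V, ℂ)) ζ := fun ζ => rfl
  have hFc : Continuous (𝓕 (B : V → ℂ)) := (𝓕 B : 𝓢(V, ℂ)).continuous
  have hQ' : Continuous (fderiv ℝ Q) := hQ.continuous_fderiv (by simp)
  have hbd : Integrable (fun ζ => (2 * Real.pi * M₀ + M₁ * Real.pi * ‖J‖) *
      (‖ζ‖ * ‖𝓕 (B : V → ℂ) ζ‖) + M₁ * ‖𝓕 (B : V → ℂ) ζ‖) := by
    have i1 := (𝓕 B : 𝓢(V, ℂ)).integrable_pow_mul volume 1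
    have i0 := (𝓕 B : 𝓢(V, ℂ)).integrable_pow_mul volume 0
    simp only [pow_one, pow_zero, one_mul] at i1 i0
    exact (i1.const_mul _).add (i0.const_mul _)
  have hcont' : Continuous (twistIntegrandDeriv J α β w τ B Q p) := by
    unfold twistIntegrandDeriv
    have c1 : Continuous fun ζ => (w + α p) + ((τ + β p) * Real.pi) • J ζ := by fun_prop
    have c2 : Continuous fun ζ => Complex.exp (2 * Real.pi * ⟪ζ, w + α p⟫ * Complex.I) := by fun_prop
    have c3 := hQ'.comp c1
    have c4 := hQ.continuous.comp c1
    refine (c2.mul hFc).smul ((Continuous.smul (continuous_const.mul c4) ?_).add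
      (c3.clm_comp ?_))
    · exact continuous_const.clm_comp ((innerSL ℝ).continuous.clm_comp continuous_const)
    · refine continuous_const.add ?_
      exact (ContinuousLinearMap.smulRightL ℝ P V β).continuous.comp
        (J.continuous.const_smul Real.pi)
  have hcont : ∀ p : P, Continuous fun ζ => Complex.exp (2 * Real.pi * ⟪ζ, w + α p⟫ * Complex.I) *
      (𝓕 (B : V → ℂ) ζ * Q ((w + α p) + ((τ + β p) * Real.pi) • J ζ)) := fun p => by
    have c1 : Continuous fun ζ => (w + α p) + ((τ + β p) * Real.pi) • J ζ := by fun_prop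
    have c2 : Continuous fun ζ => Complex.exp (2 * Real.pi * ⟪ζ, w + α p⟫ * Complex.I) := by fun_prop
    exact c2.mul (hFc.mul (hQ.continuous.comp c1))
  refine ⟨hbd.mono' hcont'.aestronglyMeasurable
    (.of_forall fun ζ => twistIntegrandDeriv_norm_le J α β w τ h0 h1 hα hβ B p ζ), ?_⟩
  simp_rw [twist_eq_integral]
  refine hasFDerivAt_integral_of_dominated_of_fderiv_le (s := univ) Filter.univ_mem
    (.of_forall fun q => (hcont q).aestronglyMeasurable) ?_ hcont'.aestronglyMeasurable
    (.of_forall fun ζ q _ => twistIntegrandDeriv_norm_le J α β w τ h0 h1 hα hβ B q ζ) hbd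
    (.of_forall fun ζ q _ => hasFDerivAt_twistIntegrand J α β w τ hQ B q ζ)
  refine Integrable.mono' (((𝓕 B : 𝓢(V, ℂ)).integrable (μ := volume)).norm.mul_const M₀)
    (hcont p).aestronglyMeasurable (.of_forall fun ζ => ?_)
  rw [norm_mul, norm_cexp_two_pi, one_mul, norm_mul]
  gcongr
  · exact le_rfl
  · exact h0 _

end Twist

/-! ### Derivatives of the twisted product and the Moyal expansion with remainder. -/

section TwistExpansion

open scoped FourierTransform RealInnerProductSpace

variable {ι V : Type*} [NormedAddCommGroup V] [InnerProductSpace ℝ V]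
  {θ η : ι → ℝ} {B Q : ι → V → ℂ}

lemma SmoothO.norm_le (hQ : SmoothO η Q) : ∃ C, 0 ≤ C ∧ ∀ i w, ‖Q i w‖ ≤ C * η i := by
  obtain ⟨C, hC0, hC⟩ := hQ.2 0
  exact ⟨C, hC0, fun i w => by simpa using hC i w⟩

lemma SmoothO.norm_fderiv_le (hQ : SmoothO η Q) :
    ∃ C, 0 ≤ C ∧ ∀ i w, ‖fderiv ℝ (Q i) w‖ ≤ C * η i := by
  obtain ⟨C, hC0, hC⟩ := hQ.2 1
  exact ⟨C, hC0, fun i w => by simpa using hC i w⟩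

variable [FiniteDimensional ℝ V] [MeasurableSpace V] [BorelSpace V] (J : V →L[ℝ] V)

lemma integrable_twistIntegrand (B : 𝓢(V, ℂ)) {Q : V → ℂ} (hQ : Continuous Q) {M : ℝ}
    (hM : ∀ w, ‖Q w‖ ≤ M) (τ : ℝ) (w : V) :
    Integrable fun ζ => Complex.exp (2 * Real.pi * ⟪ζ, w⟫ * Complex.I) *
      (𝓕 (B : V → ℂ) ζ * Q (w + (τ * Real.pi) • J ζ)) := by
  have hFc : Continuous (𝓕 (B : V → ℂ)) := (𝓕 B : 𝓢(V, ℂ)).continuous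
  refine Integrable.mono' (((𝓕 B : 𝓢(V, ℂ)).integrable (μ := volume)).norm.mul_const M)
    ?_ (.of_forall fun ζ => ?_)
  · have c1 : Continuous fun ζ => w + (τ * Real.pi) • J ζ := by fun_prop
    have c2 : Continuous fun ζ => Complex.exp (2 * Real.pi * ⟪ζ, w⟫ * Complex.I) := by fun_prop
    exact (c2.mul (hFc.mul (hQ.comp c1))).aestronglyMeasurable
  · rw [norm_mul, norm_cexp_two_pi, one_mul, norm_mul]
    exact mul_le_mul_of_nonneg_left (hM _) (norm_nonneg _)

lemma SchwartzO.integrable_twistIntegrand (hB : SchwartzO θ B) (hQ : SmoothO η Q) (i : ι)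
    (τ : ℝ) (w : V) :
    Integrable fun ζ => Complex.exp (2 * Real.pi * ⟪ζ, w⟫ * Complex.I) *
      (𝓕 (B i) ζ * Q i (w + (τ * Real.pi) • J ζ)) := by
  obtain ⟨C, -, hC⟩ := hQ.norm_le
  exact _root_.integrable_twistIntegrand J (hB.toSchwartz i) (hQ.contDiff i).continuous (hC i) τ w

lemma SchwartzO.dirDeriv_fourier (hB : SchwartzO θ B) (i : ι) (v ζ : V) :
    𝓕 (dirDeriv v (B i)) ζ = 2 * Real.pi * Complex.I * ⟪ζ, v⟫ * 𝓕 (B i) ζ :=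
  dirDeriv_fourier_schwartz (hB.toSchwartz i) v ζ

lemma SchwartzO.hasFDerivAt_twist (hB : SchwartzO θ B) (hQ : SmoothO η Q) (i : ι) (τ : ℝ) (w : V) :
    HasFDerivAt (twist J τ (B i) (Q i))
      (∫ ζ, twistIntegrandDeriv J (.id ℝ V) 0 0 τ (B i) (Q i) w ζ) w := by
  obtain ⟨C, -, hC⟩ := hQ.norm_le
  obtain ⟨D, -, hD⟩ := hQ.norm_fderiv_le
  have := (_root_.hasFDerivAt_twist J (.id ℝ V) 0 0 τ (hB.toSchwartz i) (hQ.contDiff i) (hC i)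
    (hD i) (by simp) (by simp) w).2
  simpa using this

/-- Differentiating the exponential produces `2πi⟨ζ, v⟩`, which turns `𝓕 B` into the transform of
the derivative of `B`; the other term differentiates `Q`. -/
lemma SchwartzO.dirDeriv_twist (hB : SchwartzO θ B) (hQ : SmoothO η Q) (i : ι) (τ : ℝ) (v : V) :
    dirDeriv v (twist J τ (B i) (Q i)) = fun w => twist J τ (dirDeriv v (B i)) (Q i) w +
      twist J τ (B i) (dirDeriv v (Q i)) w := by
  ext w
  obtain ⟨C, -, hC⟩ := hQ.norm_le
  obtain ⟨D, -, hD⟩ := hQ.norm_fderiv_le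
  have hint := (_root_.hasFDerivAt_twist J (.id ℝ V) 0 0 τ (hB.toSchwartz i) (hQ.contDiff i) (hC i)
    (hD i) (by simp) (by simp) w).1
  rw [SchwartzO.coe_toSchwartz] at hint
  rw [dirDeriv, (hB.hasFDerivAt_twist J hQ i τ w).fderiv, ContinuousLinearMap.integral_apply hint,
    twist_eq_integral, twist_eq_integral, ← integral_add
      ((hB.dirDeriv v).integrable_twistIntegrand J hQ i τ w)
      (hB.integrable_twistIntegrand J (hQ.dirDeriv v) i τ w)]
  refine integral_congr_ae (.of_forall fun ζ => ?_)
  simp only [hB.dirDeriv_fourier i v ζ]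
  simp [twistIntegrandDeriv, dirDeriv]
  ring

/-- The derivative in `τ` applies `DQ` to `πJζ`. Expanding `ζ` in an orthonormal basis, each
coordinate `⟨ζ, e_j⟩` times `𝓕 B` is `(2πi)⁻¹` times the transform of `∂_j B`, whence the factor `π
/ (2πi) = 1 / (2i)`. -/
lemma SchwartzO.hasDerivAt_twist (hB : SchwartzO θ B) (hQ : SmoothO η Q) (i : ι) (τ : ℝ) (w : V) :
    HasDerivAt (fun τ => twist J τ (B i) (Q i) w)
      (1 / (2 * Complex.I) * ∑ j, twist J τ (dirDeriv (stdOrthonormalBasis ℝ V j) (B i))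
        (dirDeriv (J (stdOrthonormalBasis ℝ V j)) (Q i)) w) τ := by
  obtain ⟨C, -, hC⟩ := hQ.norm_le
  obtain ⟨D, -, hD⟩ := hQ.norm_fderiv_le
  obtain ⟨hint, h⟩ := _root_.hasFDerivAt_twist J 0 (.id ℝ ℝ) w 0 (hB.toSchwartz i)
    (hQ.contDiff i) (hC i) (hD i) (by simp) (by simp) τ
  rw [SchwartzO.coe_toSchwartz] at hint
  have h2 := h.hasDerivAt
  simp only [SchwartzO.coe_toSchwartz, ContinuousLinearMap.id_apply, zero_add,
    zero_apply, add_zero] at h2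
  convert h2 using 1
  rw [ContinuousLinearMap.integral_apply hint, ← mul_one (∑ j, _), Finset.sum_mul, Finset.mul_sum]
  simp only [twist_eq_integral, mul_one, ← integral_const_mul]
  rw [← integral_finsetSum _ fun j _ => ((hB.dirDeriv _).integrable_twistIntegrand J
    (hQ.dirDeriv _) i τ w).const_mul _]
  refine integral_congr_ae (.of_forall fun ζ => ?_)
  have hJ : J ζ = ∑ j, ⟪stdOrthonormalBasis ℝ V j, ζ⟫ • J (stdOrthonormalBasis ℝ V j) := by
    conv_lhs => rw [← (stdOrthonormalBasis ℝ V).sum_repr' ζ]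
    simp
  have hF : ∀ u, fderiv ℝ (Q i) u (J ζ) = ∑ j, (⟪ζ, stdOrthonormalBasis ℝ V j⟫ : ℂ) *
      dirDeriv (J (stdOrthonormalBasis ℝ V j)) (Q i) u := fun u => by
    conv_lhs => rw [hJ]
    simp [dirDeriv, real_inner_comm]
  simp only [hB.dirDeriv_fourier]
  simp only [twistIntegrandDeriv, ContinuousLinearMap.id_apply, zero_add,
    zero_apply, add_zero, smul_apply, add_apply, ContinuousLinearMap.comp_apply,
    ContinuousLinearMap.smulRight_apply, map_zero, one_smul, map_smul, hF, smul_eq_mul, Complex.real_smul, Finset.mul_sum]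
  rw [mul_zero, zero_add, Finset.mul_sum]
  refine Finset.sum_congr rfl fun j _ => ?_
  field_simp

lemma SchwartzO.twist_zero (hB : SchwartzO θ B) (Q : V → ℂ) (i : ι) (w : V) :
    twist J 0 (B i) Q w = B i w * Q w := by
  have h1 : 𝓕⁻ (𝓕 (B i)) w = B i w := by
    have := congrArg (fun f : 𝓢(V, ℂ) => f w)
      (FourierTransform.fourierInv_fourier_eq (F := 𝓢(V, ℂ)) (hB.toSchwartz i))
    rwa [SchwartzMap.fourierInv_coe, SchwartzMap.fourier_coe] at this
  rw [twist_eq_integral, ← h1, Real.fourierInv_eq', ← integral_mul_const]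
  refine integral_congr_ae (.of_forall fun ζ => ?_)
  simp
  ring

/-- The coefficients of the Moyal expansion of the twisted product. -/
noncomputable def moyalTerm (J : V →L[ℝ] V) : ℕ → (V → ℂ) → (V → ℂ) → V → ℂ
  | 0, B, Q => fun w => B w * Q w
  | n + 1, B, Q => fun w => 1 / (n + 1) * (1 / (2 * Complex.I)) *
      ∑ j, moyalTerm J n (dirDeriv (stdOrthonormalBasis ℝ V j) B)
        (dirDeriv (J (stdOrthonormalBasis ℝ V j)) Q) w

/-- The remainder of the Moyal expansion. -/
noncomputable def moyalRem (J : V →L[ℝ] V) (N : ℕ) (τ : ℝ) (B Q : V → ℂ) (w : V) : ℂ :=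
  twist J τ B Q w - ∑ j ∈ Finset.range N, (τ : ℂ) ^ j * moyalTerm J j B Q w

omit [MeasurableSpace V] [BorelSpace V] in
protected lemma WeightedBound.moyalTerm {k : ℕ} (n : ℕ) {B Q : ι → V → ℂ} (hB : WeightedBound k θ B)
    (hQ : SmoothO η Q) :
    WeightedBound k (fun i => θ i * η i) (fun i => moyalTerm J n (B i) (Q i)) := by
  induction n generalizing B Q with
  | zero => exact hB.mul hQ
  | succ n ih =>
    exact (WeightedBound.sum _ fun j _ => ih (hB.dirDeriv _) (hQ.dirDeriv _)).const_mul' _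

lemma SchwartzO.contDiff_twist (hB : SchwartzO θ B) (hQ : SmoothO η Q) (i : ι) (τ : ℝ) :
    ContDiff ℝ ∞ (twist J τ (B i) (Q i)) := by
  rw [contDiff_infty]
  intro n
  induction n generalizing B Q with
  | zero =>
    exact contDiff_zero.2 (continuous_iff_continuousAt.2 fun w =>
      (hB.hasFDerivAt_twist J hQ i τ w).continuousAt)
  | succ n ih =>
    refine contDiff_succ_of_dirDeriv
      (fun w => (hB.hasFDerivAt_twist J hQ i τ w).differentiableAt) fun j => ?_
    rw [hB.dirDeriv_twist J hQ]
    exact (ih (hB.dirDeriv _) hQ).add (ih hB (hQ.dirDeriv _))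

omit [MeasurableSpace V] [BorelSpace V] [FiniteDimensional ℝ V] in
lemma dirDeriv_comm {f : V → ℂ} (hf : ContDiff ℝ ∞ f) (u v : V) :
    dirDeriv u (dirDeriv v f) = dirDeriv v (dirDeriv u f) := by
  have key : ∀ u v w, dirDeriv u (dirDeriv v f) w = fderiv ℝ (fderiv ℝ f) w u v := fun u v w => by
    have h1 : DifferentiableAt ℝ (fderiv ℝ f) w :=
      (hf.fderiv_right (m := ∞) (by simp)).differentiable (by simp) w
    unfold dirDeriv
    rw [fderiv_clm_apply h1 (differentiableAt_const v)]
    simp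
  ext w
  rw [key, key]
  exact (hf.contDiffAt.isSymmSndFDerivAt
    (by rw [minSmoothness_of_isRCLikeNormedField]
        exact WithTop.coe_le_coe.2 le_top)) u v

omit [MeasurableSpace V] [BorelSpace V] in
lemma contDiff_moyalTerm (n : ℕ) {B Q : V → ℂ} (hB : ContDiff ℝ ∞ B) (hQ : ContDiff ℝ ∞ Q) :
    ContDiff ℝ ∞ (moyalTerm J n B Q) := by
  induction n generalizing B Q with
  | zero => exact hB.mul hQ
  | succ n ih =>
    exact contDiff_const.mul (ContDiff.sum fun j _ => ih (hB.dirDeriv _) (hQ.dirDeriv _))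

omit [MeasurableSpace V] [BorelSpace V] in
lemma dirDeriv_moyalTerm (n : ℕ) {B Q : V → ℂ} (hB : ContDiff ℝ ∞ B) (hQ : ContDiff ℝ ∞ Q)
    (v w : V) :
    dirDeriv v (moyalTerm J n B Q) w = moyalTerm J n (dirDeriv v B) Q w +
      moyalTerm J n B (dirDeriv v Q) w := by
  induction n generalizing B Q with
  | zero =>
    have h1 := hB.differentiable (by simp) w
    have h2 := hQ.differentiable (by simp) w
    simp only [moyalTerm, dirDeriv]
    rw [fderiv_fun_mul h1 h2]
    simp
    ring
  | succ n ih =>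
    have hd : ∀ j, DifferentiableAt ℝ (moyalTerm J n (dirDeriv (stdOrthonormalBasis ℝ V j) B)
        (dirDeriv (J (stdOrthonormalBasis ℝ V j)) Q)) w := fun j =>
      (contDiff_moyalTerm J n (hB.dirDeriv _) (hQ.dirDeriv _)).differentiable (by simp) w
    simp only [moyalTerm]
    change fderiv ℝ _ w v = _
    rw [fderiv_const_mul (DifferentiableAt.fun_sum fun j _ => hd j),
      fderiv_fun_sum fun j _ => hd j, smul_apply, sum_apply, smul_eq_mul, ← mul_add,
      ← Finset.sum_add_distrib]
    congr 1
    refine Finset.sum_congr rfl fun j _ => ?_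
    rw [dirDeriv_comm hB, dirDeriv_comm hQ]
    exact ih (hB.dirDeriv _) (hQ.dirDeriv _)

lemma SchwartzO.contDiff_moyalRem (hB : SchwartzO θ B) (hQ : SmoothO η Q) (i : ι) (N : ℕ) (τ : ℝ) :
    ContDiff ℝ ∞ (moyalRem J N τ (B i) (Q i)) :=
  (hB.contDiff_twist J hQ i τ).sub (ContDiff.sum fun j _ =>
    contDiff_const.mul (contDiff_moyalTerm J j (hB.contDiff i) (hQ.contDiff i)))

lemma SchwartzO.dirDeriv_moyalRem (hB : SchwartzO θ B) (hQ : SmoothO η Q) (i : ι) (N : ℕ)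
    (τ : ℝ) (v : V) :
    dirDeriv v (moyalRem J N τ (B i) (Q i)) = fun w => moyalRem J N τ (dirDeriv v (B i)) (Q i) w +
      moyalRem J N τ (B i) (dirDeriv v (Q i)) w := by
  ext w
  have hd : ∀ j, DifferentiableAt ℝ (moyalTerm J j (B i) (Q i)) w := fun j =>
    (contDiff_moyalTerm J j (hB.contDiff i) (hQ.contDiff i)).differentiable (by simp) w
  have h1 := congrFun (hB.dirDeriv_twist J hQ i τ v) w
  have h2 : dirDeriv v (moyalRem J N τ (B i) (Q i)) w = dirDeriv v (twist J τ (B i) (Q i)) w -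
      ∑ j ∈ Finset.range N, (τ : ℂ) ^ j * dirDeriv v (moyalTerm J j (B i) (Q i)) w := by
    unfold dirDeriv moyalRem
    rw [fderiv_fun_sub ((hB.hasFDerivAt_twist J hQ i τ w).differentiableAt)
      (DifferentiableAt.fun_sum fun j _ => (hd j).const_mul _),
      fderiv_fun_sum fun j _ => (hd j).const_mul _, sub_apply, sum_apply]
    congr 1
    refine Finset.sum_congr rfl fun j _ => ?_
    rw [fderiv_const_mul (hd j), smul_apply, smul_eq_mul]
  rw [h2, h1]
  simp only [moyalRem, dirDeriv_moyalTerm J _ (hB.contDiff i) (hQ.contDiff i), mul_add,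
    Finset.sum_add_distrib]
  ring

/-- The factor `1 / (n + 1)` in `moyalTerm` cancels the exponent coming from `d/dτ τ^(n+1)`, so the
`τ`-derivative of a remainder is a combination of remainders of one order less. -/
lemma SchwartzO.hasDerivAt_moyalRem (hB : SchwartzO θ B) (hQ : SmoothO η Q) (i : ι) (N : ℕ)
    (τ : ℝ) (w : V) :
    HasDerivAt (fun τ => moyalRem J (N + 1) τ (B i) (Q i) w)
      (1 / (2 * Complex.I) * ∑ j, moyalRem J N τ (dirDeriv (stdOrthonormalBasis ℝ V j) (B i))
        (dirDeriv (J (stdOrthonormalBasis ℝ V j)) (Q i)) w) τ := by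
  have hpow : ∀ j : ℕ, HasDerivAt (fun τ : ℝ => (τ : ℂ) ^ j * moyalTerm J j (B i) (Q i) w)
      ((j * (τ : ℂ) ^ (j - 1)) * moyalTerm J j (B i) (Q i) w) τ := fun j => by
    have := ((hasDerivAt_id τ).ofReal_comp.pow j).mul_const (moyalTerm J j (B i) (Q i) w)
    simpa using this
  have h := (hB.hasDerivAt_twist J hQ i τ w).sub
    (HasDerivAt.fun_sum (u := Finset.range (N + 1)) fun j _ => hpow j)
  refine h.congr_deriv ?_
  rw [Finset.sum_range_succ']
  simp only [moyalRem, Finset.sum_sub_distrib, mul_sub, moyalTerm]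
  congr 1
  rw [Finset.sum_comm, Finset.mul_sum]
  simp only [Nat.cast_zero, zero_mul, add_zero, Nat.add_sub_cancel, ← Finset.mul_sum]
  rw [Finset.mul_sum]
  refine Finset.sum_congr rfl fun j _ => ?_
  have : (j : ℂ) + 1 ≠ 0 := by exact_mod_cast j.succ_ne_zero
  push_cast
  field_simp

/-- Induction on `N`: the remainder of order `N + 1` vanishes at `τ = 0` and its derivative is
`O(s^N)` on `[0, s]`, so the mean value inequality supplies one more factor `s`. -/
lemma SchwartzO.moyalRem_pow_bound (hB : SchwartzO θ B) (hQ : SmoothO η Q) (N k : ℕ) :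
    ∃ C, 0 ≤ C ∧ ∀ i, ∀ s ∈ Icc (0 : ℝ) 1, ∀ w,
      ‖w‖ ^ k * ‖moyalRem J N s (B i) (Q i) w‖ ≤ C * (s ^ N * (θ i * η i)) := by
  induction N generalizing B Q with
  | zero =>
    obtain ⟨C, hC0, hC⟩ := twist_pow_bound J (hB.comp_index (Prod.fst : ι × Icc (0 : ℝ) 1 → ι))
      (hQ.comp_index (Prod.fst : ι × Icc (0 : ℝ) 1 → ι)) (τ := fun j => j.2)
      (fun j => abs_le.2 ⟨by linarith [j.2.2.1], j.2.2.2⟩) k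
    exact ⟨C, hC0, fun i s hs w => by simpa [moyalRem] using hC (i, ⟨s, hs⟩) w⟩
  | succ N ih =>
    choose D hD0 hD using fun j => ih (hB.dirDeriv (stdOrthonormalBasis ℝ V j))
      (hQ.dirDeriv (J (stdOrthonormalBasis ℝ V j)))
    refine ⟨∑ j, D j, Finset.sum_nonneg fun j _ => hD0 j, fun i s hs w => ?_⟩
    have hzero : moyalRem J (N + 1) 0 (B i) (Q i) w = 0 := by
      rw [moyalRem, hB.twist_zero, Finset.sum_range_succ']
      simp [moyalTerm]
    have hbound : ∀ t ∈ Ico (0 : ℝ) s, ‖(‖w‖ ^ k : ℝ) • (1 / (2 * Complex.I) * ∑ j,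
        moyalRem J N t (dirDeriv (stdOrthonormalBasis ℝ V j) (B i))
        (dirDeriv (J (stdOrthonormalBasis ℝ V j)) (Q i)) w)‖ ≤
        (∑ j, D j) * (s ^ N * (θ i * η i)) := fun t ht => by
      have ht1 : t ∈ Icc (0 : ℝ) 1 := ⟨ht.1, ht.2.le.trans hs.2⟩
      -- The product `θ i * η i` may be negative a priori; if `D j > 0`, the inductive bound at
      -- parameter `1` shows that it is not.
      have hθη : ∀ j, D j * (t ^ N * (θ i * η i)) ≤ D j * (s ^ N * (θ i * η i)) := fun j => by
        rcases (hD0 j).eq_or_lt with h | h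
        · simp [← h]
        · have h1 : 0 ≤ D j * (1 ^ N * (θ i * η i)) :=
            (by positivity : (0 : ℝ) ≤ _).trans (hD j i 1 ⟨zero_le_one, le_rfl⟩ w)
          rw [one_pow, one_mul] at h1
          have h2 : 0 ≤ θ i * η i := nonneg_of_mul_nonneg_right h1 h
          have := pow_le_pow_left₀ ht.1 ht.2.le N
          gcongr
      rw [norm_smul, Real.norm_of_nonneg (by positivity), norm_mul]
      have h2 : ‖(1 / (2 * Complex.I) : ℂ)‖ ≤ 1 := by
        simp; norm_num
      calc _ ≤ ‖w‖ ^ k * (1 * ∑ j, ‖moyalRem J N t (dirDeriv (stdOrthonormalBasis ℝ V j) (B i))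
            (dirDeriv (J (stdOrthonormalBasis ℝ V j)) (Q i)) w‖) := by
            gcongr; exact norm_sum_le _ _
        _ = ∑ j, ‖w‖ ^ k * ‖moyalRem J N t (dirDeriv (stdOrthonormalBasis ℝ V j) (B i))
            (dirDeriv (J (stdOrthonormalBasis ℝ V j)) (Q i)) w‖ := by
            rw [one_mul, Finset.mul_sum]
        _ ≤ ∑ j, D j * (s ^ N * (θ i * η i)) :=
            Finset.sum_le_sum fun j _ => (hD j i t ht1 w).trans (hθη j)
        _ = _ := by rw [Finset.sum_mul]
    have hder : ∀ t, HasDerivAt (fun t => (‖w‖ ^ k : ℝ) • moyalRem J (N + 1) t (B i) (Q i) w) _ t :=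
      fun t => (hB.hasDerivAt_moyalRem J hQ i N t w).const_smul (‖w‖ ^ k : ℝ)
    have := norm_image_sub_le_of_norm_deriv_le_segment' (a := 0) (b := s)
      (fun t _ => (hder t).hasDerivWithinAt) hbound s ⟨hs.1, le_rfl⟩
    rw [hzero, smul_zero, sub_zero, norm_smul, Real.norm_of_nonneg (by positivity)] at this
    refine this.trans (le_of_eq ?_)
    ring

/-- By the Leibniz rule a derivative of a remainder is again a sum of remainders of the same order,
so the bound without derivatives, valid for all `B` and `Q`, propagates. -/
lemma SchwartzO.moyalRem_bound (hB : SchwartzO θ B) (hQ : SmoothO η Q) (N k n : ℕ) :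
    ∃ C, 0 ≤ C ∧ ∀ i, ∀ s ∈ Icc (0 : ℝ) 1, ∀ w,
      ‖w‖ ^ k * ‖iteratedFDeriv ℝ n (moyalRem J N s (B i) (Q i)) w‖ ≤
        C * (s ^ N * (θ i * η i)) := by
  induction n generalizing B Q with
  | zero => simpa using hB.moyalRem_pow_bound J hQ N k
  | succ n ih =>
    choose D hD0 hD using fun j => ih (hB.dirDeriv (stdOrthonormalBasis ℝ V j)) hQ
    choose E hE0 hE using fun j => ih hB (hQ.dirDeriv (stdOrthonormalBasis ℝ V j))
    refine ⟨∑ j, (D j + E j), Finset.sum_nonneg fun j _ => add_nonneg (hD0 j) (hE0 j),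
      fun i s hs w => ?_⟩
    refine (mul_le_mul_of_nonneg_left (norm_iteratedFDeriv_succ_le_sum_dirDeriv
      (hB.contDiff_moyalRem J hQ i N s) n w) (by positivity)).trans ?_
    rw [Finset.mul_sum, Finset.sum_mul]
    refine Finset.sum_le_sum fun j _ => ?_
    rw [hB.dirDeriv_moyalRem J hQ]
    have h1 := (hB.dirDeriv (stdOrthonormalBasis ℝ V j)).contDiff_moyalRem J hQ i N s
    have h2 := hB.contDiff_moyalRem J (hQ.dirDeriv (stdOrthonormalBasis ℝ V j)) i N s
    have := iteratedFDeriv_add_apply (i := n) (x := w) (h1.of_le (mod_cast le_top)).contDiffAt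
      (h2.of_le (mod_cast le_top)).contDiffAt
    rw [show (fun w => moyalRem J N s (dirDeriv (stdOrthonormalBasis ℝ V j) (B i)) (Q i) w +
      moyalRem J N s (B i) (dirDeriv (stdOrthonormalBasis ℝ V j) (Q i)) w) = _ + _ from rfl, this,
      add_mul]
    refine (mul_le_mul_of_nonneg_left (norm_add_le _ _) (by positivity)).trans ?_
    rw [mul_add]
    exact add_le_add (hD j i s hs w) (hE j i s hs w)

protected lemma SchwartzO.moyalRem (hB : SchwartzO θ B) (hQ : SmoothO η Q) (N : ℕ) {τ : ι → ℝ}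
    (hτ : ∀ i, τ i ∈ Icc (0 : ℝ) 1) :
    SchwartzO (fun i => τ i ^ N * (θ i * η i)) (fun i => moyalRem J N (τ i) (B i) (Q i)) := by
  refine fun k => ⟨fun i => hB.contDiff_moyalRem J hQ i N _, fun n => ?_⟩
  obtain ⟨C, hC0, hC⟩ := hB.moyalRem_bound J hQ N k n
  exact ⟨C, hC0, fun i w => hC i _ (hτ i) w⟩

protected lemma SchwartzO.twist (hB : SchwartzO θ B) (hQ : SmoothO η Q) {τ : ι → ℝ}
    (hτ : ∀ i, τ i ∈ Icc (0 : ℝ) 1) :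
    SchwartzO (fun i => θ i * η i) (fun i => twist J (τ i) (B i) (Q i)) := by
  -- The remainder of order zero is the twisted product itself.
  have := hB.moyalRem J hQ 0 hτ
  have h1 : ∀ i, moyalRem J 0 (τ i) (B i) (Q i) = twist J (τ i) (B i) (Q i) := fun i => by
    ext w; simp [moyalRem]
  simpa only [pow_zero, one_mul, h1] using this

end TwistExpansion

/-! ### Weyl quantization of Schwartz symbols -/

section WeylSchwartz

open scoped FourierTransform RealInnerProductSpace

variable {d : ℕ}

lemma SchwartzO.exists_decay {ι V : Type*} [NormedAddCommGroup V] [InnerProductSpace ℝ V]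
    {θ : ι → ℝ} {B : ι → V → ℂ} (hB : SchwartzO θ B) (r n : ℕ) :
    ∃ C, 0 ≤ C ∧ ∀ i w, (1 + ‖w‖) ^ r * ‖iteratedFDeriv ℝ n (B i) w‖ ≤ C * θ i := by
  obtain ⟨C, hC0, hC⟩ := (hB 0).2 n
  obtain ⟨D, hD0, hD⟩ := (hB r).2 n
  refine ⟨2 ^ (r - 1) * (C + D), by positivity, fun i w => ?_⟩
  have h1 := hC i w
  have h2 := hD i w
  rw [pow_zero, one_mul] at h1
  set t := ‖iteratedFDeriv ℝ n (B i) w‖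
  calc _ ≤ 2 ^ (r - 1) * (1 ^ r + ‖w‖ ^ r) * t := by
        gcongr; exact add_pow_le zero_le_one (norm_nonneg w) r
    _ = 2 ^ (r - 1) * (t + ‖w‖ ^ r * t) := by ring
    _ ≤ 2 ^ (r - 1) * (C * θ i + D * θ i) := by gcongr
    _ = _ := by ring

/-- An integrable bounded weight on configuration space. -/
noncomputable def decayWeight (d : ℕ) (x : ConfSpace d) : ℝ := ((1 + ‖x‖) ^ (d + 1))⁻¹

lemma decayWeight_pos (x : ConfSpace d) : 0 < decayWeight d x := by
  unfold decayWeight; positivity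

lemma decayWeight_le_one (x : ConfSpace d) : decayWeight d x ≤ 1 :=
  inv_le_one_of_one_le₀ (one_le_pow₀ (by linarith [norm_nonneg x]))

lemma integrable_decayWeight : Integrable (decayWeight d) := by
  have h := integrable_one_add_norm (E := ConfSpace d) (μ := volume) (r := ((d + 1 : ℕ) : ℝ))
    (by simp)
  refine h.congr (.of_forall fun x => ?_)
  rw [decayWeight, ← Real.rpow_natCast, ← Real.rpow_neg (by positivity)]

/-- A product weight, integrable in position and momentum separately, as needed for Fubini; the
decay of order `2 (d + 1)` is shared equally between them. -/
lemma SchwartzMap.norm_le_decayWeight_mul (B : 𝓢(PhaseSpace d, ℂ)) :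
    ∃ C, 0 ≤ C ∧ ∀ x ξ : ConfSpace d,
      ‖B (WithLp.toLp 2 (x, ξ))‖ ≤ C * (decayWeight d x * decayWeight d ξ) := by
  obtain ⟨C, hC0, hC⟩ := (SchwartzMap.schwartzO (ι := Unit) B).exists_decay (2 * (d + 1)) 0
  refine ⟨C, hC0, fun x ξ => ?_⟩
  have h := hC () (WithLp.toLp 2 (x, ξ))
  have h1 : ‖x‖ ≤ ‖(WithLp.toLp 2 (x, ξ) : PhaseSpace d)‖ :=
    WithLp.norm_fst_le _ (WithLp.toLp 2 (x, ξ))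
  have h2 : ‖ξ‖ ≤ ‖(WithLp.toLp 2 (x, ξ) : PhaseSpace d)‖ :=
    WithLp.norm_snd_le _ (WithLp.toLp 2 (x, ξ))
  rw [mul_one, two_mul, pow_add, norm_iteratedFDeriv_zero] at h
  rw [decayWeight, decayWeight, ← mul_inv, ← div_eq_mul_inv, le_div_iff₀ (by positivity), mul_comm]
  refine le_trans (mul_le_mul_of_nonneg_right ?_ (norm_nonneg _)) h
  exact mul_le_mul (pow_le_pow_left₀ (by positivity) (by linarith) _)
    (pow_le_pow_left₀ (by positivity) (by linarith) _) (by positivity) (by positivity)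

lemma integrable_decayWeight_comp (X : ConfSpace d) :
    Integrable fun y => decayWeight d ((1 / 2 : ℝ) • (X + y)) := by
  have h1 : Integrable fun y => decayWeight d ((1 / 2 : ℝ) • y) :=
    integrable_decayWeight.comp_smul (by norm_num)
  exact h1.comp_add_left X

lemma integral_decayWeight_comp (X : ConfSpace d) :
    ∫ y, decayWeight d ((1 / 2 : ℝ) • (X + y)) = ∫ y, decayWeight d ((1 / 2 : ℝ) • y) :=
  integral_add_left_eq_self (fun y => decayWeight d ((1 / 2 : ℝ) • y)) X

/-- The standard symplectic map of phase space. -/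
noncomputable def symplecticMap (d : ℕ) : PhaseSpace d →L[ℝ] PhaseSpace d :=
  (WithLp.prodContinuousLinearEquiv 2 ℝ (ConfSpace d) (ConfSpace d)).symm.toContinuousLinearMap ∘L
    ((ContinuousLinearMap.snd ℝ _ _).prod (-ContinuousLinearMap.fst ℝ _ _)) ∘L
    (WithLp.prodContinuousLinearEquiv 2 ℝ (ConfSpace d) (ConfSpace d)).toContinuousLinearMap

lemma integral_phaseSpace (f : PhaseSpace d → ℂ) :
    ∫ z, f z = ∫ q : ConfSpace d × ConfSpace d, f (WithLp.toLp 2 q) :=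
  ((WithLp.volume_preserving_toLp _ _).integral_comp
    (MeasurableEquiv.toLp 2 (ConfSpace d × ConfSpace d)).measurableEmbedding f).symm

lemma integrable_phaseSpace_iff (f : PhaseSpace d → ℂ) :
    Integrable (fun q : ConfSpace d × ConfSpace d => f (WithLp.toLp 2 q)) ↔ Integrable f :=
  (WithLp.volume_preserving_toLp _ _).integrable_comp_emb
    (MeasurableEquiv.toLp 2 (ConfSpace d × ConfSpace d)).measurableEmbedding

/-- Fourier inversion in the first group of variables. -/
lemma integral_cexp_schwartz_eq (B : 𝓢(PhaseSpace d, ℂ)) (m s : ConfSpace d) :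
    ∫ ξ, Complex.exp (-2 * Real.pi * Complex.I * ⟪ξ, s⟫) * B (WithLp.toLp 2 (m, ξ)) =
      ∫ ζ₁, Complex.exp (2 * Real.pi * Complex.I * ⟪ζ₁, m⟫) *
        𝓕 (B : PhaseSpace d → ℂ) (WithLp.toLp 2 (ζ₁, s)) := by
  obtain ⟨C, hC0, hC⟩ := B.norm_le_decayWeight_mul
  obtain ⟨D, hD0, hD⟩ := (𝓕 B : 𝓢(PhaseSpace d, ℂ)).norm_le_decayWeight_mul
  have hnorm : ∀ x : ℝ, ‖Complex.exp (-2 * Real.pi * Complex.I * x)‖ = 1 := fun x => by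
    have := Complex.norm_exp_ofReal_mul_I (-2 * Real.pi * x)
    rw [← this]; push_cast; ring_nf
  set f : ConfSpace d → ℂ := fun m =>
    ∫ ξ, Complex.exp (-2 * Real.pi * Complex.I * ⟪ξ, s⟫) * B (WithLp.toLp 2 (m, ξ)) with hf
  have hBint : Integrable fun q : ConfSpace d × ConfSpace d => B (WithLp.toLp 2 q) :=
    (integrable_phaseSpace_iff _).2 B.integrable
  have hmul : ∀ g : ConfSpace d × ConfSpace d → ℂ, Continuous g → (∀ q, ‖g q‖ = 1) →
      Integrable fun q : ConfSpace d × ConfSpace d => g q * B (WithLp.toLp 2 q) := fun g hg h1 =>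
    hBint.bdd_mul hg.aestronglyMeasurable (c := 1) (.of_forall fun q => (h1 q).le)
  have hcont : Continuous f := by
    refine continuous_of_dominated (bound := fun ξ => C * decayWeight d ξ) (fun m => ?_)
      (fun m => .of_forall fun ξ => ?_) (integrable_decayWeight.const_mul C)
      (.of_forall fun ξ => ?_)
    · have := B.continuous
      exact Continuous.aestronglyMeasurable (by fun_prop)
    · rw [norm_mul, hnorm, one_mul]
      refine (hC m ξ).trans ?_
      have := mul_le_mul_of_nonneg_right (decayWeight_le_one m) (decayWeight_pos ξ).le
      rw [one_mul] at this
      gcongr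
    · have := B.continuous
      fun_prop
  have hfint : Integrable f := by
    refine Integrable.integral_prod_left (f := fun q : ConfSpace d × ConfSpace d =>
      Complex.exp (-2 * Real.pi * Complex.I * ⟪q.2, s⟫) * B (WithLp.toLp 2 q)) ?_
    exact hmul _ (by fun_prop) fun q => hnorm _
  have hFf : 𝓕 f = fun ζ₁ => 𝓕 (B : PhaseSpace d → ℂ) (WithLp.toLp 2 (ζ₁, s)) := by
    ext ζ₁
    rw [Real.fourier_eq', Real.fourier_eq', integral_phaseSpace, Measure.volume_eq_prod, integral_prod]
    · refine integral_congr_ae (.of_forall fun m => ?_)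
      simp only [hf, smul_eq_mul, ← integral_const_mul]
      refine integral_congr_ae (.of_forall fun ξ => ?_)
      simp only [WithLp.prod_inner_apply, ← mul_assoc, ← Complex.exp_add]
      congr 2
      push_cast
      ring
    · simp only [smul_eq_mul]
      refine hmul _ (by fun_prop) fun q => ?_
      exact Complex.norm_exp_ofReal_mul_I _
  have hFint : Integrable (𝓕 f) := by
    rw [hFf]
    refine (integrable_decayWeight.const_mul D).mono' ?_ (.of_forall fun ζ₁ => ?_)
    · have : Continuous (𝓕 (B : PhaseSpace d → ℂ)) := (𝓕 B : 𝓢(PhaseSpace d, ℂ)).continuous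
      exact Continuous.aestronglyMeasurable (by fun_prop)
    · refine (hD ζ₁ s).trans ?_
      have := mul_le_mul_of_nonneg_left (decayWeight_le_one s) (decayWeight_pos ζ₁).le
      rw [mul_one] at this
      gcongr
  have hinv := congrFun (hcont.fourierInv_fourier_eq hfint hFint) m
  change f m = _
  rw [← hinv, hFf, Real.fourierInv_eq']
  refine integral_congr_ae (.of_forall fun ζ₁ => ?_)
  simp only [smul_eq_mul]
  congr 2
  push_cast
  ring

end WeylSchwartz

/-! ### Composition of Weyl operators as a twisted product. -/

section WeylProduct

open scoped FourierTransform RealInnerProductSpace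

variable {d : ℕ}

lemma norm_cexp_I_mul (x : ℝ) : ‖Complex.exp (Complex.I * x)‖ = 1 := by
  rw [mul_comm]; exact Complex.norm_exp_ofReal_mul_I x

/-- The phase of the Weyl operator of an exponential. -/
noncomputable def weylPhase (x : ConfSpace d) (ζ : PhaseSpace d) : ℂ :=
  Complex.exp (Complex.I * (2 * Real.pi * (⟪ζ.fst, x⟫ + Real.pi * ⟪ζ.fst, ζ.snd⟫) : ℝ))

lemma norm_weylPhase (x : ConfSpace d) (ζ : PhaseSpace d) : ‖weylPhase x ζ‖ = 1 :=
  norm_cexp_I_mul _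

lemma continuous_weylPhase (x : ConfSpace d) : Continuous (weylPhase x) := by
  unfold weylPhase
  fun_prop

lemma integrable_weylKernel (B : 𝓢(PhaseSpace d, ℂ)) {v : ConfSpace d → ℂ} (hv : Measurable v)
    {M : ℝ} (hM : ∀ y, ‖v y‖ ≤ M) (x : ConfSpace d) :
    Integrable fun q : ConfSpace d × ConfSpace d =>
      Complex.exp (Complex.I * ((inner ℝ (x - q.2) q.1 : ℝ) : ℂ)) *
        B (WithLp.toLp 2 ((1 / 2 : ℝ) • (x + q.2), q.1)) * v q.2 := by
  obtain ⟨C, hC0, hC⟩ := B.norm_le_decayWeight_mul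
  have hM0 : 0 ≤ M := (norm_nonneg _).trans (hM 0)
  have hg : Integrable fun q : ConfSpace d × ConfSpace d =>
      (C * M) * (decayWeight d q.1 * decayWeight d ((1 / 2 : ℝ) • (x + q.2))) :=
    (integrable_decayWeight.mul_prod (integrable_decayWeight_comp x)).const_mul _
  refine hg.mono' ?_ (.of_forall fun q => ?_)
  · have h1 := B.continuous
    have h2 : Continuous fun q : ConfSpace d × ConfSpace d =>
      Complex.exp (Complex.I * ((inner ℝ (x - q.2) q.1 : ℝ) : ℂ)) *
        B (WithLp.toLp 2 ((1 / 2 : ℝ) • (x + q.2), q.1)) := by fun_prop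
    exact (h2.measurable.mul (hv.comp measurable_snd)).aestronglyMeasurable
  · rw [norm_mul, norm_mul, norm_cexp_I_mul, one_mul]
    have := mul_le_mul (hC ((1 / 2 : ℝ) • (x + q.2)) q.1) (hM q.2) (norm_nonneg _)
      (mul_nonneg hC0 (mul_pos (decayWeight_pos _) (decayWeight_pos _)).le)
    refine this.trans (le_of_eq (by ring))

/-- Fourier inversion writes `B` as a superposition of exponentials, and each exponential quantizes
to a phase times a translation by `2π ζ.snd`. Only boundedness and measurability of `v` are used,
which is all that is known later about `v = a^w u`. -/
lemma weylOp_schwartz (B : 𝓢(PhaseSpace d, ℂ)) {v : ConfSpace d → ℂ} (hv : Measurable v)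
    {M : ℝ} (hM : ∀ y, ‖v y‖ ≤ M) (x : ConfSpace d) :
    weylOp B v x = ∫ ζ, weylPhase x ζ * 𝓕 (B : PhaseSpace d → ℂ) ζ *
      v (x + (2 * Real.pi) • ζ.snd) := by
  have hpi := Real.pi_pos
  obtain ⟨D, hD0, hD⟩ := (𝓕 B : 𝓢(PhaseSpace d, ℂ)).norm_le_decayWeight_mul
  have hM0 : 0 ≤ M := (norm_nonneg _).trans (hM 0)
  rw [weylOp, integral_integral_swap (integrable_weylKernel B hv hM x)]
  -- The substitution `y = x + 2πs` absorbs the normalizing constant.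
  have hsub : ∀ f : ConfSpace d → ℂ, (((2 * Real.pi) ^ d : ℝ) : ℂ)⁻¹ * ∫ y, f y =
      ∫ s, f (x + (2 * Real.pi) • s) := fun f => by
    rw [Measure.integral_comp_smul volume (fun y => f (x + y)) (2 * Real.pi),
      integral_add_left_eq_self, finrank_euclideanSpace_fin, abs_of_pos (by positivity),
      Complex.real_smul]
    push_cast
    rfl
  rw [hsub, integral_phaseSpace, Measure.volume_eq_prod, integral_prod_symm]
  · refine integral_congr_ae (.of_forall fun s => ?_)
    have hs : ∀ ζ₁ : ConfSpace d, (WithLp.toLp 2 (ζ₁, s) : PhaseSpace d).snd = s := fun _ => rfl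
    simp only [integral_mul_const, hs]
    congr 1
    have hp : ∀ ζ₁ : ConfSpace d, weylPhase x (WithLp.toLp 2 (ζ₁, s)) =
        Complex.exp (2 * Real.pi * Complex.I * ⟪ζ₁, x + Real.pi • s⟫) := fun ζ₁ => by
      have h1 : (WithLp.toLp 2 (ζ₁, s) : PhaseSpace d).fst = ζ₁ := rfl
      have h2 : (WithLp.toLp 2 (ζ₁, s) : PhaseSpace d).snd = s := rfl
      simp only [weylPhase, inner_add_right, inner_smul_right, h1, h2]
      congr 1
      push_cast
      ring
    simp only [hp]
    rw [← integral_cexp_schwartz_eq B (x + Real.pi • s) s]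
    refine integral_congr_ae (.of_forall fun ξ => ?_)
    have e1 : (1 / 2 : ℝ) • (x + (x + (2 * Real.pi) • s)) = x + Real.pi • s := by
      module
    have e2 : x - (x + (2 * Real.pi) • s) = (-2 * Real.pi) • s := by module
    simp only [e1, e2]
    congr 2
    rw [inner_smul_left, real_inner_comm]
    simp
    ring
  · have hg : Integrable fun q : ConfSpace d × ConfSpace d =>
        (D * M) * (decayWeight d q.1 * decayWeight d q.2) :=
      (integrable_decayWeight.mul_prod integrable_decayWeight).const_mul _
    refine hg.mono' ?_ (.of_forall fun q => ?_)
    · have h1 : Continuous (𝓕 (B : PhaseSpace d → ℂ)) := (𝓕 B : 𝓢(PhaseSpace d, ℂ)).continuous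
      have h0 := continuous_weylPhase x
      have h2 : Continuous fun q : ConfSpace d × ConfSpace d =>
        weylPhase x (WithLp.toLp 2 q) * 𝓕 (B : PhaseSpace d → ℂ) (WithLp.toLp 2 q) := by
        fun_prop
      have h3 : Measurable fun q : ConfSpace d × ConfSpace d => v (x + (2 * Real.pi) • q.2) :=
        hv.comp (by fun_prop)
      exact (h2.measurable.mul h3).aestronglyMeasurable
    · rw [norm_mul, norm_mul, norm_weylPhase, one_mul]
      have := mul_le_mul (hD q.1 q.2) (hM (x + (2 * Real.pi) • q.2)) (norm_nonneg _)
        (mul_nonneg hD0 (mul_pos (decayWeight_pos _) (decayWeight_pos _)).le)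
      refine this.trans (le_of_eq (by ring))

/-- A symbol `a` and a function `v` for which the iterated integral of Weyl quantization converges
absolutely, uniformly in the base point. -/
structure WeylAdmissible (a : PhaseSpace d → ℂ) (v : ConfSpace d → ℂ) : Prop where
  continuous : Continuous a
  measurable : Measurable v
  integrable : ∀ X ξ : ConfSpace d,
    Integrable fun y => a (WithLp.toLp 2 ((1 / 2 : ℝ) • (X + y), ξ)) * v y
  bound : ∃ M : ℝ, ∀ X ξ : ConfSpace d,
    ∫ y, ‖a (WithLp.toLp 2 ((1 / 2 : ℝ) • (X + y), ξ)) * v y‖ ≤ M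
  decay : ∃ G : ConfSpace d → ℝ, Integrable G ∧ ∀ X ξ : ConfSpace d,
    ‖∫ y, Complex.exp (Complex.I * ((inner ℝ (X - y) ξ : ℝ) : ℂ)) *
      a (WithLp.toLp 2 ((1 / 2 : ℝ) • (X + y), ξ)) * v y‖ ≤ G ξ

namespace WeylAdmissible

variable {a : PhaseSpace d → ℂ} {v : ConfSpace d → ℂ}

lemma stronglyMeasurable_inner (h : WeylAdmissible a v) :
    StronglyMeasurable fun q : ConfSpace d × ConfSpace d =>
      ∫ y, Complex.exp (Complex.I * ((inner ℝ (q.1 - y) q.2 : ℝ) : ℂ)) *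
        a (WithLp.toLp 2 ((1 / 2 : ℝ) • (q.1 + y), q.2)) * v y := by
  refine StronglyMeasurable.integral_prod_right'
    (f := fun r : (ConfSpace d × ConfSpace d) × ConfSpace d =>
      Complex.exp (Complex.I * ((inner ℝ (r.1.1 - r.2) r.1.2 : ℝ) : ℂ)) *
        a (WithLp.toLp 2 ((1 / 2 : ℝ) • (r.1.1 + r.2), r.1.2)) * v r.2) ?_
  have h1 := h.continuous
  have h2 : Continuous fun r : (ConfSpace d × ConfSpace d) × ConfSpace d =>
      Complex.exp (Complex.I * ((inner ℝ (r.1.1 - r.2) r.1.2 : ℝ) : ℂ)) *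
        a (WithLp.toLp 2 ((1 / 2 : ℝ) • (r.1.1 + r.2), r.1.2)) := by fun_prop
  exact (h2.measurable.mul (h.measurable.comp measurable_snd)).stronglyMeasurable

lemma measurable_weylOp (h : WeylAdmissible a v) : Measurable (weylOp a v) := by
  unfold weylOp
  exact (StronglyMeasurable.integral_prod_right' h.stronglyMeasurable_inner).measurable.const_mul _

lemma exists_bound_weylOp (h : WeylAdmissible a v) : ∃ M, ∀ x, ‖weylOp a v x‖ ≤ M := by
  obtain ⟨G, hG, hle⟩ := h.decay
  refine ⟨‖(((2 * Real.pi) ^ d : ℝ) : ℂ)⁻¹‖ * ∫ ξ, G ξ, fun x => ?_⟩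
  rw [weylOp, norm_mul]
  gcongr
  exact norm_integral_le_of_norm_le hG (.of_forall fun ξ => hle x ξ)

/-- Insert `a^w v` into the formula of `weylOp_schwartz`, translate `ξ` by `π ζ.fst`, and move the
`ζ`-integral innermost. The symbol `a` is then evaluated at the midpoint shifted by `πJζ`, and the
`ζ`-integral is the twisted product. -/
lemma weylOp_twist (B : 𝓢(PhaseSpace d, ℂ)) (h : WeylAdmissible a v) (x : ConfSpace d) :
    weylOp (twist (symplecticMap d) 1 B a) v x = weylOp B (weylOp a v) x := by
  obtain ⟨M, hM⟩ := h.exists_bound_weylOp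
  obtain ⟨G, hG, hle⟩ := h.decay
  obtain ⟨A, hA⟩ := h.bound
  have hFc : Continuous (𝓕 (B : PhaseSpace d → ℂ)) := (𝓕 B : 𝓢(PhaseSpace d, ℂ)).continuous
  have hFi : Integrable (𝓕 (B : PhaseSpace d → ℂ)) := (𝓕 B : 𝓢(PhaseSpace d, ℂ)).integrable
  set g : ConfSpace d → ConfSpace d → ℂ := fun X ξ =>
    ∫ y, Complex.exp (Complex.I * ((inner ℝ (X - y) ξ : ℝ) : ℂ)) *
      a (WithLp.toLp 2 ((1 / 2 : ℝ) • (X + y), ξ)) * v y with hg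
  have hshift : ∀ ζ : PhaseSpace d, weylOp a v (x + (2 * Real.pi) • ζ.snd) =
      (((2 * Real.pi) ^ d : ℝ) : ℂ)⁻¹ *
        ∫ ξ, g (x + (2 * Real.pi) • ζ.snd) (ξ - Real.pi • ζ.fst) := fun ζ => by
    rw [integral_sub_right_eq_self (fun ξ => g (x + (2 * Real.pi) • ζ.snd) ξ)]
    rfl
  have hmeas : Measurable fun q : PhaseSpace d × ConfSpace d =>
      g (x + (2 * Real.pi) • q.1.snd) (q.2 - Real.pi • q.1.fst) :=
    h.stronglyMeasurable_inner.measurable.comp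
      (f := fun q : PhaseSpace d × ConfSpace d =>
        (x + (2 * Real.pi) • q.1.snd, q.2 - Real.pi • q.1.fst)) (by fun_prop)
  have hGi : ∀ u : ConfSpace d, Integrable fun ξ => G (ξ - u) := fun u => hG.comp_sub_right u
  -- The integrand need not be absolutely integrable in `(ξ, y)` jointly, so `ζ` is exchanged first
  -- with `ξ`, using the integrable majorant `G` of the inner integral, and then with `y` for fixed
  -- `ξ`, using the uniform bound `A`.
  have hint1 : Integrable (fun q : PhaseSpace d × ConfSpace d =>
      weylPhase x q.1 * 𝓕 (B : PhaseSpace d → ℂ) q.1 *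
        g (x + (2 * Real.pi) • q.1.snd) (q.2 - Real.pi • q.1.fst)) := by
    have hm : Measurable fun q : PhaseSpace d × ConfSpace d =>
      weylPhase x q.1 * 𝓕 (B : PhaseSpace d → ℂ) q.1 *
        g (x + (2 * Real.pi) • q.1.snd) (q.2 - Real.pi • q.1.fst) :=
      (((continuous_weylPhase x).measurable.comp measurable_fst).mul
        (hFc.measurable.comp measurable_fst)).mul hmeas
    have hb : ∀ (ζ : PhaseSpace d) (ξ : ConfSpace d),
        ‖g (x + (2 * Real.pi) • ζ.snd) (ξ - Real.pi • ζ.fst)‖ ≤ G (ξ - Real.pi • ζ.fst) :=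
      fun ζ ξ => hle _ _
    have hgi : ∀ ζ : PhaseSpace d,
        Integrable fun ξ => g (x + (2 * Real.pi) • ζ.snd) (ξ - Real.pi • ζ.fst) := fun ζ =>
      (hGi _).mono' (hmeas.comp measurable_prodMk_left).aestronglyMeasurable
        (.of_forall fun ξ => hb ζ ξ)
    refine (integrable_prod_iff hm.aestronglyMeasurable).2
      ⟨.of_forall fun ζ => (hgi ζ).const_mul (weylPhase x ζ * 𝓕 (B : PhaseSpace d → ℂ) ζ), ?_⟩
    refine (hFi.norm.mul_const (∫ ξ, G ξ)).mono'
      (hm.norm.stronglyMeasurable.integral_prod_right').aestronglyMeasurable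
      (.of_forall fun ζ => ?_)
    rw [Real.norm_of_nonneg (integral_nonneg fun _ => norm_nonneg _)]
    simp only [norm_mul, norm_weylPhase, one_mul, integral_const_mul]
    refine mul_le_mul_of_nonneg_left ?_ (norm_nonneg _)
    calc _ ≤ ∫ ξ, G (ξ - Real.pi • ζ.fst) :=
          integral_mono (hgi ζ).norm (hGi _) fun ξ => hb ζ ξ
      _ = _ := integral_sub_right_eq_self G _
  have hint2 : ∀ ξ : ConfSpace d, Integrable (fun q : PhaseSpace d × ConfSpace d =>
      weylPhase x q.1 * 𝓕 (B : PhaseSpace d → ℂ) q.1 *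
        (Complex.exp (Complex.I * ((inner ℝ (x + (2 * Real.pi) • q.1.snd - q.2)
            (ξ - Real.pi • q.1.fst) : ℝ) : ℂ)) *
          a (WithLp.toLp 2 ((1 / 2 : ℝ) • (x + (2 * Real.pi) • q.1.snd + q.2),
            ξ - Real.pi • q.1.fst)) * v q.2)) := fun ξ => by
    have hc := h.continuous
    have hwp := continuous_weylPhase x
    have hcont : Continuous fun q : PhaseSpace d × ConfSpace d =>
        weylPhase x q.1 * 𝓕 (B : PhaseSpace d → ℂ) q.1 *
        (Complex.exp (Complex.I * ((inner ℝ (x + (2 * Real.pi) • q.1.snd - q.2)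
            (ξ - Real.pi • q.1.fst) : ℝ) : ℂ)) *
          a (WithLp.toLp 2 ((1 / 2 : ℝ) • (x + (2 * Real.pi) • q.1.snd + q.2),
            ξ - Real.pi • q.1.fst))) := by fun_prop
    have hm : Measurable fun q : PhaseSpace d × ConfSpace d =>
        weylPhase x q.1 * 𝓕 (B : PhaseSpace d → ℂ) q.1 *
        (Complex.exp (Complex.I * ((inner ℝ (x + (2 * Real.pi) • q.1.snd - q.2)
            (ξ - Real.pi • q.1.fst) : ℝ) : ℂ)) *
          a (WithLp.toLp 2 ((1 / 2 : ℝ) • (x + (2 * Real.pi) • q.1.snd + q.2),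
            ξ - Real.pi • q.1.fst))) * v q.2 :=
      hcont.measurable.mul (h.measurable.comp measurable_snd)
    simp only [mul_assoc] at hm ⊢
    refine (integrable_prod_iff hm.aestronglyMeasurable).2 ⟨.of_forall fun ζ => ?_, ?_⟩
    · have h1 := (h.integrable (x + (2 * Real.pi) • ζ.snd) (ξ - Real.pi • ζ.fst)).bdd_mul
        (f := fun y => weylPhase x ζ * 𝓕 (B : PhaseSpace d → ℂ) ζ *
          Complex.exp (Complex.I * ((inner ℝ (x + (2 * Real.pi) • ζ.snd - y)
            (ξ - Real.pi • ζ.fst) : ℝ) : ℂ))) (c := ‖𝓕 (B : PhaseSpace d → ℂ) ζ‖)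
        (Continuous.aestronglyMeasurable (by fun_prop))
        (.of_forall fun y => by
          rw [norm_mul, norm_mul, norm_weylPhase, norm_cexp_I_mul, one_mul, mul_one])
      simpa only [mul_assoc] using h1
    · refine (hFi.norm.mul_const A).mono'
        (hm.norm.stronglyMeasurable.integral_prod_right').aestronglyMeasurable
        (.of_forall fun ζ => ?_)
      rw [Real.norm_of_nonneg (integral_nonneg fun _ => norm_nonneg _)]
      simp only [norm_mul, norm_weylPhase, norm_cexp_I_mul, one_mul]
      simp only [integral_const_mul]
      refine mul_le_mul_of_nonneg_left ?_ (norm_nonneg _)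
      simpa only [norm_mul] using hA (x + (2 * Real.pi) • ζ.snd) (ξ - Real.pi • ζ.fst)
  rw [weylOp_schwartz B h.measurable_weylOp hM x]
  simp only [hshift]
  have e1 : ∀ ζ : PhaseSpace d, weylPhase x ζ * 𝓕 (B : PhaseSpace d → ℂ) ζ *
      ((((2 * Real.pi) ^ d : ℝ) : ℂ)⁻¹ *
        ∫ ξ, g (x + (2 * Real.pi) • ζ.snd) (ξ - Real.pi • ζ.fst)) =
      (((2 * Real.pi) ^ d : ℝ) : ℂ)⁻¹ * ∫ ξ, weylPhase x ζ * 𝓕 (B : PhaseSpace d → ℂ) ζ *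
        g (x + (2 * Real.pi) • ζ.snd) (ξ - Real.pi • ζ.fst) := fun ζ => by
    rw [integral_const_mul]; ring
  simp only [e1]
  rw [integral_const_mul, integral_integral_swap hint1, weylOp]
  congr 1
  refine integral_congr_ae (.of_forall fun ξ => ?_)
  simp only [hg, ← integral_const_mul]
  rw [integral_integral_swap (hint2 ξ)]
  refine integral_congr_ae (.of_forall fun y => ?_)
  simp only [twist_eq_integral, ← integral_const_mul, ← integral_mul_const]
  refine integral_congr_ae (.of_forall fun ζ => ?_)
  have hpt : (WithLp.toLp 2 ((1 / 2 : ℝ) • (x + y), ξ) : PhaseSpace d) +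
      ((1 * Real.pi : ℝ)) • symplecticMap d ζ =
      WithLp.toLp 2 ((1 / 2 : ℝ) • (x + (2 * Real.pi) • ζ.snd + y), ξ - Real.pi • ζ.fst) := by
    apply WithLp.ofLp_injective 2
    refine Prod.ext ?_ ?_
    · change (1 / 2 : ℝ) • (x + y) + (1 * Real.pi) • ζ.snd = _
      module
    · change ξ + (1 * Real.pi) • (-ζ.fst) = _
      module
  simp only [hpt]
  have hph : Complex.exp (Complex.I * ((inner ℝ (x - y) ξ : ℝ) : ℂ)) *
      Complex.exp (2 * Real.pi *
        ⟪ζ, (WithLp.toLp 2 ((1 / 2 : ℝ) • (x + y), ξ) : PhaseSpace d)⟫ * Complex.I) =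
      weylPhase x ζ * Complex.exp (Complex.I * ((inner ℝ (x + (2 * Real.pi) • ζ.snd - y)
            (ξ - Real.pi • ζ.fst) : ℝ) : ℂ)) := by
    rw [weylPhase, ← Complex.exp_add, ← Complex.exp_add, WithLp.prod_inner_apply]
    congr 1
    change Complex.I * ((inner ℝ (x - y) ξ : ℝ) : ℂ) + 2 * Real.pi *
      ((⟪ζ.fst, (1 / 2 : ℝ) • (x + y)⟫ + ⟪ζ.snd, ξ⟫ : ℝ) : ℂ) * Complex.I = _
    simp only [inner_add_left, inner_sub_left, inner_sub_right, inner_smul_left, inner_smul_right,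
      inner_add_right, conj_trivial]
    rw [real_inner_comm ζ.fst x, real_inner_comm ζ.fst y, real_inner_comm ζ.fst ζ.snd]
    push_cast
    ring
  linear_combination (𝓕 (B : PhaseSpace d → ℂ) ζ * a (WithLp.toLp 2
    ((1 / 2 : ℝ) • (x + (2 * Real.pi) • ζ.snd + y), ξ - Real.pi • ζ.fst)) * v y) * hph

end WeylAdmissible

end WeylProduct

/-! ### Admissible pairs, Weyl products with a Schwartz factor, and dilation. -/

section ShubinFamilies

open scoped FourierTransform RealInnerProductSpace

variable {d : ℕ}

/-- Covers the middle factor of a triple product, which acts on `a^w u`. -/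
lemma WeylAdmissible.of_schwartz_symbol (B : 𝓢(PhaseSpace d, ℂ)) {v : ConfSpace d → ℂ}
    (hv : Measurable v) {M : ℝ} (hM : ∀ y, ‖v y‖ ≤ M) : WeylAdmissible B v := by
  obtain ⟨C, hC0, hC⟩ := B.norm_le_decayWeight_mul
  have hM0 : 0 ≤ M := (norm_nonneg _).trans (hM 0)
  have hB := B.continuous
  have hle : ∀ X ξ y : ConfSpace d, ‖B (WithLp.toLp 2 ((1 / 2 : ℝ) • (X + y), ξ)) * v y‖ ≤
      C * M * decayWeight d ξ * decayWeight d ((1 / 2 : ℝ) • (X + y)) := fun X ξ y => by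
    rw [norm_mul]
    have := mul_le_mul (hC ((1 / 2 : ℝ) • (X + y)) ξ) (hM y) (norm_nonneg _)
      (mul_nonneg hC0 (mul_pos (decayWeight_pos _) (decayWeight_pos _)).le)
    exact this.trans (le_of_eq (by ring))
  have hmeas : ∀ X ξ : ConfSpace d,
      Measurable fun y => B (WithLp.toLp 2 ((1 / 2 : ℝ) • (X + y), ξ)) * v y := fun X ξ =>
    (Continuous.measurable (by fun_prop)).mul hv
  have hgi : ∀ X ξ : ConfSpace d, Integrable fun y =>
      C * M * decayWeight d ξ * decayWeight d ((1 / 2 : ℝ) • (X + y)) := fun X ξ =>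
    (integrable_decayWeight_comp X).const_mul _
  have hint : ∀ X ξ : ConfSpace d,
      Integrable fun y => B (WithLp.toLp 2 ((1 / 2 : ℝ) • (X + y), ξ)) * v y := fun X ξ =>
    (hgi X ξ).mono' (hmeas X ξ).aestronglyMeasurable (.of_forall fun y => hle X ξ y)
  have hbd : ∀ X ξ : ConfSpace d,
      ∫ y, ‖B (WithLp.toLp 2 ((1 / 2 : ℝ) • (X + y), ξ)) * v y‖ ≤
        C * M * decayWeight d ξ * ∫ y, decayWeight d ((1 / 2 : ℝ) • y) := fun X ξ => by
    rw [← integral_decayWeight_comp X, ← integral_const_mul]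
    exact integral_mono (hint X ξ).norm (hgi X ξ) fun y => hle X ξ y
  refine ⟨hB, hv, hint, ⟨C * M * ∫ y, decayWeight d ((1 / 2 : ℝ) • y), fun X ξ =>
    (hbd X ξ).trans ?_⟩, fun ξ => C * M * decayWeight d ξ * ∫ y, decayWeight d ((1 / 2 : ℝ) • y),
    (integrable_decayWeight.const_mul _).mul_const _, fun X ξ => ?_⟩
  · refine mul_le_mul_of_nonneg_right ?_ (integral_nonneg fun y => (decayWeight_pos _).le)
    exact mul_le_of_le_one_right (by positivity) (decayWeight_le_one ξ)
  · refine (norm_integral_le_integral_norm _).trans (le_trans (le_of_eq ?_) (hbd X ξ))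
    refine integral_congr_ae (.of_forall fun y => ?_)
    simp only [norm_mul, norm_cexp_I_mul, one_mul]

/-- Up to a phase the inner integral is the Fourier transform in `y` of `u(y) a((X + y)/2, ξ)`. With
`(X, ξ)` as an index these functions are uniformly Schwartz, so evaluating the transform at `ξ / 2π`
gives integrable decay in `ξ`, uniformly in `X`. -/
lemma WeylAdmissible.of_smooth_bounded {a : PhaseSpace d → ℂ}
    (ha : SmoothO (fun _ : Unit => 1) fun _ => a) (u : 𝓢(ConfSpace d, ℂ)) :
    WeylAdmissible a u := by
  have hac : Continuous a := (ha.contDiff ()).continuous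
  have huc := u.continuous
  obtain ⟨M, hM0, hM⟩ := ha.norm_le
  have hM' : ∀ z, ‖a z‖ ≤ M := fun z => by simpa using hM () z
  have hint : ∀ X ξ : ConfSpace d,
      Integrable fun y => a (WithLp.toLp 2 ((1 / 2 : ℝ) • (X + y), ξ)) * u y := fun X ξ =>
    u.integrable.bdd_mul (Continuous.aestronglyMeasurable (by fun_prop)) (c := M)
      (.of_forall fun y => hM' _)
  let L : ConfSpace d →L[ℝ] PhaseSpace d :=
    (WithLp.prodContinuousLinearEquiv 2 ℝ (ConfSpace d) (ConfSpace d)).symm.toContinuousLinearMap ∘L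
      ((1 / 2 : ℝ) • ContinuousLinearMap.inl ℝ (ConfSpace d) (ConfSpace d))
  have hL : ∀ X ξ y : ConfSpace d, (WithLp.toLp 2 ((1 / 2 : ℝ) • X, ξ) : PhaseSpace d) + L y =
      WithLp.toLp 2 ((1 / 2 : ℝ) • (X + y), ξ) := fun X ξ y => by
    apply WithLp.ofLp_injective 2
    refine Prod.ext ?_ ?_
    · change (1 / 2 : ℝ) • X + (1 / 2 : ℝ) • y = (1 / 2 : ℝ) • (X + y)
      rw [smul_add]
    · change ξ + (1 / 2 : ℝ) • (0 : ConfSpace d) = ξ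
      simp
  have hΦ := (SchwartzMap.schwartzO (ι := ConfSpace d × ConfSpace d) u).mul
    ((ha.comp_index (fun _ : ConfSpace d × ConfSpace d => ())).comp_affine
      (fun q => WithLp.toLp 2 ((1 / 2 : ℝ) • q.1, q.2)) (fun _ => L) (fun _ => le_rfl))
  simp only [hL, mul_one] at hΦ
  obtain ⟨C, hC0, hC⟩ := hΦ.fourier.exists_decay (d + 1) 0
  refine ⟨hac, huc.measurable, hint, ⟨M * ∫ y, ‖u y‖, fun X ξ => ?_⟩,
    fun ξ => C * decayWeight d ((2 * Real.pi)⁻¹ • ξ),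
    (integrable_decayWeight.comp_smul (by positivity)).const_mul C, fun X ξ => ?_⟩
  · rw [← integral_const_mul]
    refine integral_mono (hint X ξ).norm (u.integrable.norm.const_mul M) fun y => ?_
    simp only [norm_mul]
    exact mul_le_mul_of_nonneg_right (hM' _) (norm_nonneg _)
  · have e : ∫ y, Complex.exp (Complex.I * ((inner ℝ (X - y) ξ : ℝ) : ℂ)) *
        a (WithLp.toLp 2 ((1 / 2 : ℝ) • (X + y), ξ)) * u y =
        Complex.exp (Complex.I * ((inner ℝ X ξ : ℝ) : ℂ)) *
          𝓕 (fun y => u y * a (WithLp.toLp 2 ((1 / 2 : ℝ) • (X + y), ξ))) ((2 * Real.pi)⁻¹ • ξ) := by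
      rw [Real.fourier_eq', ← integral_const_mul]
      refine integral_congr_ae (.of_forall fun y => ?_)
      simp only [smul_eq_mul, inner_sub_left, inner_smul_right]
      have hpi : (Real.pi : ℂ) ≠ 0 := by exact_mod_cast Real.pi_ne_zero
      have : Complex.exp (Complex.I * ((inner ℝ X ξ - inner ℝ y ξ : ℝ) : ℂ)) =
          Complex.exp (Complex.I * ((inner ℝ X ξ : ℝ) : ℂ)) *
          Complex.exp (((-2 * Real.pi * ((2 * Real.pi)⁻¹ * inner ℝ y ξ) : ℝ) : ℂ) * Complex.I) := by
        rw [← Complex.exp_add]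
        congr 1
        push_cast
        field_simp
        ring
      rw [this]
      ring
    change _ ≤ C * decayWeight d ((2 * Real.pi)⁻¹ • ξ)
    rw [e, norm_mul, norm_cexp_I_mul, one_mul, decayWeight, ← div_eq_mul_inv,
      le_div_iff₀ (by positivity), mul_comm]
    simpa using hC (X, ξ) ((2 * Real.pi)⁻¹ • ξ)

lemma one_le_japaneseBracket (z : PhaseSpace d) : 1 ≤ japaneseBracket z := by
  rw [japaneseBracket, Real.one_le_sqrt]
  nlinarith [sq_nonneg ‖z‖]

lemma japaneseBracket_le (z : PhaseSpace d) : japaneseBracket z ≤ 1 + ‖z‖ :=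
  sqrt_one_add_norm_sq_le z

lemma SchwartzO.exists_bracket_bound {ι : Type*} {θ : ι → ℝ} {B : ι → PhaseSpace d → ℂ}
    (hB : SchwartzO θ B) (r : ℝ) (n : ℕ) :
    ∃ C, 0 ≤ C ∧ ∀ i w, ‖iteratedFDeriv ℝ n (B i) w‖ ≤ C * θ i * japaneseBracket w ^ r := by
  obtain ⟨k, hk⟩ := exists_nat_ge (-r)
  obtain ⟨C, hC0, hC⟩ := hB.exists_decay k n
  refine ⟨C, hC0, fun i w => ?_⟩
  have h1 := one_le_japaneseBracket w
  have hpos : 0 < japaneseBracket w := by linarith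
  have hCθ : 0 ≤ C * θ i := (by positivity : (0 : ℝ) ≤ _).trans (hC i w)
  have h2 : ‖iteratedFDeriv ℝ n (B i) w‖ ≤ C * θ i * japaneseBracket w ^ (-(k : ℝ)) := by
    rw [Real.rpow_neg hpos.le, Real.rpow_natCast, ← div_eq_mul_inv, le_div_iff₀ (by positivity),
      mul_comm]
    refine le_trans ?_ (hC i w)
    gcongr
    exact japaneseBracket_le w
  refine h2.trans (mul_le_mul_of_nonneg_left ?_ hCθ)
  exact Real.rpow_le_rpow_of_exponent_le h1 (by linarith)

lemma SchwartzMap.isShubinSymbol (B : 𝓢(PhaseSpace d, ℂ)) (m : ℝ) : IsShubinSymbol m B := by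
  refine ⟨B.smooth ⊤, fun n => ?_⟩
  obtain ⟨C, -, hC⟩ := (SchwartzMap.schwartzO (ι := Unit) B).exists_bracket_bound (m - n) n
  exact ⟨C, fun z => by simpa using hC () z⟩

lemma exists_schwartz_twist (B : 𝓢(PhaseSpace d, ℂ)) {a : PhaseSpace d → ℂ}
    (ha : SmoothO (fun _ : Unit => 1) fun _ => a) :
    ∃ S : 𝓢(PhaseSpace d, ℂ), (S : PhaseSpace d → ℂ) = twist (symplecticMap d) 1 B a :=
  ⟨((SchwartzMap.schwartzO (ι := Unit) B).twist (symplecticMap d) ha (τ := fun _ => 1)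
    (by simp)).toSchwartz (), rfl⟩

lemma SchwartzMap.smoothO {V : Type*} [NormedAddCommGroup V] [InnerProductSpace ℝ V]
    (B : 𝓢(V, ℂ)) : SmoothO (fun _ : Unit => 1) fun _ => B :=
  (SchwartzMap.schwartzO B).smoothO

lemma SchwartzMap.exists_norm_le {V : Type*} [NormedAddCommGroup V] [InnerProductSpace ℝ V]
    (B : 𝓢(V, ℂ)) : ∃ M, ∀ y, ‖B y‖ ≤ M := by
  obtain ⟨M, -, hM⟩ := B.smoothO.norm_le
  exact ⟨M, fun y => by simpa using hM () y⟩

lemma isWeylProduct_twist (B : 𝓢(PhaseSpace d, ℂ)) {a : PhaseSpace d → ℂ}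
    (ha : SmoothO (fun _ : Unit => 1) fun _ => a) :
    IsWeylProduct B a (twist (symplecticMap d) 1 B a) := by
  obtain ⟨S, hS⟩ := exists_schwartz_twist B ha
  exact ⟨⟨0, hS ▸ S.isShubinSymbol 0⟩,
    fun u x => (WeylAdmissible.of_smooth_bounded ha u).weylOp_twist B x⟩

/-- Associativity is taken from operators: both sides equal `B^w C^w a^w u`, by three uses of
`weylOp_twist`. No associativity of `twist` is proved. -/
lemma isWeylProduct_twist_twist (B C : 𝓢(PhaseSpace d, ℂ)) {a : PhaseSpace d → ℂ}
    (ha : SmoothO (fun _ : Unit => 1) fun _ => a) :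
    IsWeylProduct (twist (symplecticMap d) 1 B C) a
      (twist (symplecticMap d) 1 B (twist (symplecticMap d) 1 C a)) := by
  obtain ⟨S, hS⟩ := exists_schwartz_twist C ha
  obtain ⟨P, hP⟩ := exists_schwartz_twist B S.smoothO
  rw [← hS]
  refine ⟨⟨0, hP ▸ P.isShubinSymbol 0⟩, fun u x => ?_⟩
  have hau := WeylAdmissible.of_smooth_bounded ha u
  obtain ⟨M, hM⟩ := hau.exists_bound_weylOp
  rw [(WeylAdmissible.of_smooth_bounded S.smoothO u).weylOp_twist B x,
    (WeylAdmissible.of_schwartz_symbol C hau.measurable_weylOp hM).weylOp_twist B x]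
  congr 1
  ext y
  rw [hS]
  exact hau.weylOp_twist C y

/-- The rescaling `ζ ↦ hζ` compensates the Jacobian in the transform of the dilated `B`. The shift
of `Q` acquires one factor `h` from the dilation of `Q` and another from `ζ`, so the new parameter
is `h²`. -/
lemma twist_comp_smul {V : Type*} [NormedAddCommGroup V] [InnerProductSpace ℝ V]
    [FiniteDimensional ℝ V] [MeasurableSpace V] [BorelSpace V] (J : V →L[ℝ] V) {h : ℝ} (hh : 0 < h)
    (B Q : V → ℂ) (z : V) :
    twist J 1 (fun z => B (h • z)) (fun z => Q (h • z)) z = twist J (h ^ 2) B Q (h • z) := by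
  have hF : ∀ ζ, 𝓕 (fun z => B (h • z)) ζ =
      ((h ^ Module.finrank ℝ V)⁻¹ : ℝ) • 𝓕 B (h⁻¹ • ζ) := fun ζ => by
    rw [Real.fourier_eq', Real.fourier_eq']
    have := Measure.integral_comp_smul volume (fun v : V =>
      Complex.exp (((-2 * Real.pi * inner ℝ v (h⁻¹ • ζ) : ℝ) : ℂ) * Complex.I) • B v) h
    rw [abs_of_pos (by positivity)] at this
    rw [← this]
    refine integral_congr_ae (.of_forall fun v => ?_)
    simp only [inner_smul_left, inner_smul_right, conj_trivial]
    congr 4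
    field_simp
  rw [twist_eq_integral, twist_eq_integral]
  have := Measure.integral_comp_smul volume (fun ζ : V =>
    Complex.exp (2 * Real.pi * ⟪ζ, z⟫ * Complex.I) *
      (𝓕 B (h⁻¹ • ζ) * Q (h • z + (h * Real.pi) • J ζ))) h
  rw [abs_of_pos (by positivity)] at this
  calc _ = ((h ^ Module.finrank ℝ V)⁻¹ : ℝ) • ∫ ζ, Complex.exp (2 * Real.pi * ⟪ζ, z⟫ * Complex.I) *
      (𝓕 B (h⁻¹ • ζ) * Q (h • z + (h * Real.pi) • J ζ)) := by
        rw [← integral_smul]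
        refine integral_congr_ae (.of_forall fun ζ => ?_)
        simp only [hF, smul_add, smul_smul, one_mul, Complex.real_smul]
        ring
    _ = _ := by
        rw [← this]
        refine integral_congr_ae (.of_forall fun ζ => ?_)
        simp only [map_smul, smul_smul, inner_smul_left, inner_smul_right, conj_trivial,
          inv_mul_cancel₀ hh.ne', one_smul]
        congr 4
        ring_nf

lemma norm_iteratedFDeriv_comp_smul {V : Type*} [NormedAddCommGroup V] [InnerProductSpace ℝ V]
    {f : V → ℂ} (hf : ContDiff ℝ ∞ f) {h : ℝ} (hh : 0 ≤ h) (n : ℕ) (z : V) :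
    ‖iteratedFDeriv ℝ n (fun z => f (h • z)) z‖ = h ^ n * ‖iteratedFDeriv ℝ n f (h • z)‖ := by
  rw [iteratedFDeriv_comp_const_smul h (hf.of_le (mod_cast le_top))]
  simp [norm_smul, abs_of_nonneg hh]

/-- A uniformly Schwartz family gives, after dilation, an `h`-Shubin symbol of any order. -/
lemma SchwartzO.dilate_mem_hShubinClass {B : ℝ → PhaseSpace d → ℂ}
    (hB : SchwartzO (fun _ : Ioc (0 : ℝ) 1 => 1) fun h => B h) (m : ℝ) :
    (fun h z => B h (h • z)) ∈ hShubinClass d m := by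
  refine ⟨fun h hh => (hB.contDiff ⟨h, hh⟩).comp (contDiff_id.const_smul h), fun n => ?_⟩
  obtain ⟨C, hC0, hC⟩ := hB.exists_bracket_bound (m - n) n
  refine ⟨C, fun h hh z => ?_⟩
  rw [norm_iteratedFDeriv_comp_smul (hB.contDiff ⟨h, hh⟩) hh.1.le]
  have := mul_le_mul_of_nonneg_left (hC ⟨h, hh⟩ (h • z)) (pow_nonneg hh.1.le n)
  refine this.trans (le_of_eq (by ring))

/-- Taking `N = k` leaves `h^{2k}`, of which `h^k` may be divided out; Schwartz decay in `w` yields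
the order `-k`. -/
lemma dilate_mem_hNegligible {R : ℝ → PhaseSpace d → ℂ}
    (hR : ∀ N : ℕ, SchwartzO (fun h : Ioc (0 : ℝ) 1 => ((h : ℝ) ^ 2) ^ N) fun h => R h) :
    (fun h z => R h (h • z)) ∈ hNegligible d := by
  intro k
  have hS : SchwartzO (fun _ : Ioc (0 : ℝ) 1 => 1)
      fun (h : Ioc (0 : ℝ) 1) w => ((h : ℂ) ^ k)⁻¹ * R h w := by
    refine ((hR k).const_mul (c := fun h : Ioc (0 : ℝ) 1 => (((h : ℝ) : ℂ) ^ k)⁻¹)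
      (η := fun h : Ioc (0 : ℝ) 1 => ((h : ℝ) ^ k)⁻¹) fun h => ?_).mono zero_le_one fun h => ?_
    · simp [abs_of_pos h.2.1]
    · have h0 : (0 : ℝ) < h := h.2.1
      rw [one_mul, ← div_eq_mul_inv, ← pow_mul, two_mul, pow_add,
        mul_div_cancel_right₀ _ (by positivity)]
      exact pow_le_one₀ h0.le h.2.2
  refine ⟨fun h z => ((h : ℂ) ^ k)⁻¹ * R h (h • z),
    hS.dilate_mem_hShubinClass (B := fun h w => ((h : ℂ) ^ k)⁻¹ * R h w) (-(k : ℝ)),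
    fun h hh z => ?_⟩
  have : (h : ℂ) ≠ 0 := by exact_mod_cast hh.1.ne'
  field_simp

/-- The rescaled symbol `w ↦ a(w / h; h)` of an `h`-Shubin symbol of order zero. -/
lemma smoothO_of_mem_hShubinClass {a : ℝ → PhaseSpace d → ℂ} (ha : a ∈ hShubinClass d 0) :
    SmoothO (fun _ : Ioc (0 : ℝ) 1 => 1) fun h w => a h ((h : ℝ)⁻¹ • w) := by
  refine ⟨fun h => (ha.1 h h.2).comp (contDiff_id.const_smul (h : ℝ)⁻¹), fun n => ?_⟩
  obtain ⟨C, hC⟩ := ha.2 n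
  refine ⟨|C|, abs_nonneg C, fun h w => ?_⟩
  have h0 : (0 : ℝ) < h := h.2.1
  rw [norm_iteratedFDeriv_comp_smul (ha.1 h h.2) (by positivity), pow_zero, one_mul, mul_one,
    inv_pow, inv_mul_le_iff₀ (by positivity)]
  refine (hC h h.2 _).trans ?_
  have h1 : japaneseBracket ((h : ℝ) • (h : ℝ)⁻¹ • w) ^ (0 - (n : ℝ)) ≤ 1 :=
    Real.rpow_le_one_of_one_le_of_nonpos (one_le_japaneseBracket _) (by simp)
  have h2 : 0 ≤ japaneseBracket ((h : ℝ) • (h : ℝ)⁻¹ • w) ^ (0 - (n : ℝ)) :=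
    Real.rpow_nonneg (zero_le_one.trans (one_le_japaneseBracket _)) _
  calc _ ≤ |C| * (h : ℝ) ^ n * japaneseBracket ((h : ℝ) • (h : ℝ)⁻¹ • w) ^ (0 - (n : ℝ)) := by
        gcongr; exact le_abs_self C
    _ ≤ |C| * (h : ℝ) ^ n * 1 := by gcongr
    _ = _ := by ring

end ShubinFamilies

section Parametrix

variable {d : ℕ}

/-! ### Joint smoothness -/

lemma IsJointlySmooth.mul {f g : ℝ → PhaseSpace d → ℂ} (hf : IsJointlySmooth f)
    (hg : IsJointlySmooth g) : IsJointlySmooth fun h w => f h w * g h w := ContDiffOn.mul hf hg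

lemma IsJointlySmooth.sum {κ : Type*} {f : κ → ℝ → PhaseSpace d → ℂ} (s : Finset κ)
    (hf : ∀ j ∈ s, IsJointlySmooth (f j)) : IsJointlySmooth fun h w => ∑ j ∈ s, f j h w :=
  ContDiffOn.sum hf

lemma isJointlySmooth_const_right {f : PhaseSpace d → ℂ} (hf : ContDiff ℝ ∞ f) :
    IsJointlySmooth fun _ w => f w := (hf.comp contDiff_snd).contDiffOn

lemma isJointlySmooth_const_left {f : ℝ → ℂ} (hf : ContDiff ℝ ∞ f) :
    IsJointlySmooth fun h (_ : PhaseSpace d) => f h := (hf.comp contDiff_fst).contDiffOn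

/-- The partial derivative is the derivative of the joint function within `S ×ˢ univ`, applied to
`(0, v)`. Unique differentiability allows the endpoint `h = 1`. -/
lemma ContDiffOn.dirDeriv_snd {V : Type*} [NormedAddCommGroup V] [InnerProductSpace ℝ V] {S : Set ℝ}
    (hS : UniqueDiffOn ℝ S) {f : ℝ → V → ℂ}
    (hf : ContDiffOn ℝ ∞ (fun q : ℝ × V => f q.1 q.2) (S ×ˢ univ)) (v : V) :
    ContDiffOn ℝ ∞ (fun q : ℝ × V => dirDeriv v (f q.1) q.2) (S ×ˢ univ) := by
  have hS' : UniqueDiffOn ℝ (S ×ˢ (univ : Set V)) := hS.prod uniqueDiffOn_univ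
  have h1 := (ContDiffOn.fderivWithin hf hS' (m := ∞) (by simp)).clm_apply
    (contDiffOn_const (c := ((0 : ℝ), v)))
  refine h1.congr fun q hq => ?_
  have h2 := (hf.differentiableOn (by simp) q hq).hasFDerivWithinAt
  have h3 : HasFDerivAt (fun w : V => (q.1, w))
      (ContinuousLinearMap.inr ℝ ℝ V) q.2 := hasFDerivAt_prodMk_right q.1 q.2
  have h4 := h2.comp_hasFDerivAt q.2 h3 (.of_forall fun w => mk_mem_prod hq.1 (mem_univ w))
  have h5 : HasFDerivAt (f q.1) _ q.2 := h4
  simp [dirDeriv, h5.fderiv]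

lemma IsJointlySmooth.dirDeriv {f : ℝ → PhaseSpace d → ℂ} (hf : IsJointlySmooth f)
    (v : PhaseSpace d) : IsJointlySmooth fun h => dirDeriv v (f h) :=
  ContDiffOn.dirDeriv_snd (uniqueDiffOn_Ioc 0 1) hf v

lemma IsJointlySmooth.moyalTerm (J : PhaseSpace d →L[ℝ] PhaseSpace d) (n : ℕ)
    {f g : ℝ → PhaseSpace d → ℂ} (hf : IsJointlySmooth f) (hg : IsJointlySmooth g) :
    IsJointlySmooth fun h => moyalTerm J n (f h) (g h) := by
  induction n generalizing f g with
  | zero => exact hf.mul hg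
  | succ n ih =>
    exact (isJointlySmooth_const_left contDiff_const).mul
      (IsJointlySmooth.sum _ fun j _ => ih (hf.dirDeriv _) (hg.dirDeriv _))

/-! ### Borel summation -/

/-- The cutoffs used in the Borel summation. -/
noncomputable def borelCutoff (lam h : ℝ) : ℝ := Real.smoothTransition (2 - lam * h)

lemma borelCutoff_nonneg (lam h : ℝ) : 0 ≤ borelCutoff lam h := Real.smoothTransition.nonneg _

lemma borelCutoff_le_one (lam h : ℝ) : borelCutoff lam h ≤ 1 := Real.smoothTransition.le_one _

lemma borelCutoff_eq_zero {lam h : ℝ} (hl : 2 ≤ lam * h) : borelCutoff lam h = 0 :=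
  Real.smoothTransition.zero_of_nonpos (by linarith)

lemma borelCutoff_eq_one {lam h : ℝ} (hl : lam * h ≤ 1) : borelCutoff lam h = 1 :=
  Real.smoothTransition.one_of_one_le (by linarith)

lemma contDiff_borelCutoff (lam : ℝ) : ContDiff ℝ ∞ (borelCutoff lam) :=
  Real.smoothTransition.contDiff.comp (contDiff_const.sub (contDiff_const.mul contDiff_id))

/-- The Borel sum of the series `∑ h ^ (2 j) c_j`. -/
noncomputable def borelSum (lam : ℕ → ℝ) (c : ℕ → ℝ → PhaseSpace d → ℂ) (h : ℝ)
    (w : PhaseSpace d) : ℂ :=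
  ∑ j ∈ Finset.range ⌈2 / h⌉₊, ((borelCutoff (lam j) h * (h ^ 2) ^ j : ℝ) : ℂ) * c j h w

/-- For `j ≥ 2 / h` the condition `lam j ≥ j` makes the cutoff vanish, so any larger truncation
gives the same sum. -/
lemma borelSum_eq {lam : ℕ → ℝ} (hlam : ∀ j : ℕ, (j : ℝ) ≤ lam j) (c : ℕ → ℝ → PhaseSpace d → ℂ)
    {h : ℝ} (hh : 0 < h) {L : ℕ} (hL : ⌈2 / h⌉₊ ≤ L) (w : PhaseSpace d) :
    borelSum lam c h w =
      ∑ j ∈ Finset.range L, ((borelCutoff (lam j) h * (h ^ 2) ^ j : ℝ) : ℂ) * c j h w := by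
  refine Finset.sum_subset (Finset.range_mono hL) fun j _ hj => ?_
  rw [Finset.mem_range, not_lt] at hj
  have h1 : 2 / h ≤ j := (Nat.le_ceil _).trans (by exact_mod_cast hj)
  rw [div_le_iff₀ hh] at h1
  rw [borelCutoff_eq_zero (h1.trans (by gcongr; exact hlam j))]
  simp

lemma isJointlySmooth_borelSum {lam : ℕ → ℝ} (hlam : ∀ j : ℕ, (j : ℝ) ≤ lam j)
    {c : ℕ → ℝ → PhaseSpace d → ℂ} (hc : ∀ j, IsJointlySmooth (c j)) :
    IsJointlySmooth (borelSum lam c) := by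
  intro q hq
  have hq0 : 0 < q.1 := hq.1.1
  -- For parameters `h > q.1 / 2` one has `2 / h < 4 / q.1`, so one finite sum represents the Borel
  -- sum near `q`.
  set L := ⌈4 / q.1⌉₊
  have hfin : IsJointlySmooth fun h w => ∑ j ∈ Finset.range L,
      ((borelCutoff (lam j) h * (h ^ 2) ^ j : ℝ) : ℂ) * c j h w := by
    refine IsJointlySmooth.sum _ fun j _ => IsJointlySmooth.mul
      (isJointlySmooth_const_left (Complex.ofRealCLM.contDiff.comp
        ((contDiff_borelCutoff _).mul ((contDiff_id.pow 2).pow j)))) (hc j)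
  refine (hfin q hq).congr_of_eventuallyEq ?_ ?_
  · have hopen : {p : ℝ × PhaseSpace d | q.1 / 2 < p.1} ∈ nhds q :=
      (isOpen_lt continuous_const continuous_fst).mem_nhds (by simp [hq0])
    filter_upwards [mem_nhdsWithin_of_mem_nhds hopen] with p hp
    have hp' : q.1 / 2 < p.1 := hp
    refine borelSum_eq hlam c (by linarith) (Nat.ceil_mono ?_) p.2
    rw [div_le_div_iff₀ (by linarith) hq0]
    linarith
  · refine borelSum_eq hlam c hq0 (Nat.ceil_mono ?_) q.2
    gcongr
    norm_num

/-- Where the cutoff differs from `1`, `lam * h > 1` and the right side is at least `1`. Thus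
inserting a cutoff costs `O(h^{2N})` for every `N`. -/
lemma norm_borelCutoff_sub_one_le {lam h : ℝ} (hh : 0 < h) (N : ℕ) :
    |borelCutoff lam h - 1| ≤ (lam ^ 2) ^ N * (h ^ 2) ^ N := by
  rcases le_or_gt (lam * h) 1 with h1 | h1
  · rw [borelCutoff_eq_one h1, sub_self, abs_zero]; positivity
  · have h2 := borelCutoff_nonneg lam h
    have h3 := borelCutoff_le_one lam h
    rw [← mul_pow, ← mul_pow, ← pow_mul]
    exact (abs_le.2 ⟨by linarith, by linarith⟩).trans (one_le_pow₀ h1.le)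

lemma exists_borelSum {c : ℕ → ℝ → PhaseSpace d → ℂ}
    (hc : ∀ j, SchwartzO (fun _ : Ioc (0 : ℝ) 1 => 1) fun h => c j h) :
    ∃ lam : ℕ → ℝ, (∀ j : ℕ, (j : ℝ) ≤ lam j) ∧ ∀ N : ℕ,
      SchwartzO (fun h : Ioc (0 : ℝ) 1 => ((h : ℝ) ^ 2) ^ N) fun h w => borelSum lam c h w -
        ∑ j ∈ Finset.range N, (((h : ℝ) ^ 2 : ℝ) : ℂ) ^ j * c j h w := by
  choose K hK0 hK using fun j k => (hc j k).2
  set M : ℕ → ℝ := fun j => ∑ k ∈ Finset.range (j + 1), ∑ n ∈ Finset.range (j + 1), K j k n with hMdef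
  have hM0 : ∀ j, 0 ≤ M j := fun j =>
    Finset.sum_nonneg fun k _ => Finset.sum_nonneg fun n _ => hK0 j k n
  have hM : ∀ j k n, k ≤ j → n ≤ j → ∀ (h : Ioc (0 : ℝ) 1) w,
      ‖w‖ ^ k * ‖iteratedFDeriv ℝ n (c j h) w‖ ≤ M j := fun j k n hk hn h w => by
    have h1 := hK j k n h w
    rw [mul_one] at h1
    refine h1.trans ?_
    have h2 : K j k n ≤ ∑ n ∈ Finset.range (j + 1), K j k n :=
      Finset.single_le_sum (f := fun n => K j k n) (fun n _ => hK0 j k n)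
        (Finset.mem_range.2 (by omega))
    exact h2.trans (Finset.single_le_sum (f := fun k => ∑ n ∈ Finset.range (j + 1), K j k n)
      (fun k _ => Finset.sum_nonneg fun n _ => hK0 j k n) (Finset.mem_range.2 (by omega)))
  -- Where the `j`-th cutoff is nonzero, `lam j * h < 2`, that is `h (M j + 1) < 2^{-j}`. The size
  -- `M j` of the seminorms of index at most `j` is thereby paid for by one factor `h`.
  set lam : ℕ → ℝ := fun j => 2 ^ (j + 1) * (M j + 1) with hlamdef
  have hlam : ∀ j : ℕ, (j : ℝ) ≤ lam j := fun j => by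
    have h1 : (j : ℝ) ≤ 2 ^ (j + 1) := by
      exact_mod_cast (Nat.lt_two_pow_self.le.trans (Nat.pow_le_pow_right (by norm_num) (by omega)))
    calc (j : ℝ) ≤ 2 ^ (j + 1) * 1 := by linarith
      _ ≤ lam j := by
        have := hM0 j
        simp only [hlamdef]
        gcongr
        linarith
  refine ⟨lam, hlam, fun N k => ?_⟩
  have hterm : ∀ j, N < j → ∀ h : Ioc (0 : ℝ) 1,
      borelCutoff (lam j) h * ((h : ℝ) ^ 2) ^ j * M j ≤ (1 / 2) ^ j * ((h : ℝ) ^ 2) ^ N := by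
    intro j hj h
    have h0 : (0 : ℝ) < h := h.2.1
    rcases le_or_gt 2 (lam j * h) with h1 | h1
    · rw [borelCutoff_eq_zero h1]; simp; positivity
    · have h2 : (h : ℝ) ^ 2 * M j ≤ (1 / 2) ^ j := by
        have e : (h : ℝ) * M j ≤ (1 / 2) ^ j := by
          rw [one_div, inv_pow, ← one_div, le_div_iff₀ (by positivity)]
          have h3 : 2 ^ (j + 1) * (M j + 1) * (h : ℝ) < 2 := h1
          have h4 : (2 : ℝ) ^ (j + 1) = 2 * 2 ^ j := by ring
          rw [h4] at h3
          have h5 : (0 : ℝ) < 2 ^ j := by positivity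
          nlinarith [mul_pos h5 h0]
        calc (h : ℝ) ^ 2 * M j = h * (h * M j) := by ring
          _ ≤ 1 * (h * M j) := by
            have := hM0 j
            gcongr
            exact h.2.2
          _ ≤ _ := by linarith
      obtain ⟨i, rfl⟩ := Nat.exists_eq_add_of_lt hj
      have h3 : ((h : ℝ) ^ 2) ^ i ≤ 1 := pow_le_one₀ (by positivity)
        (pow_le_one₀ h0.le h.2.2)
      calc borelCutoff (lam (N + i + 1)) h * ((h : ℝ) ^ 2) ^ (N + i + 1) * M (N + i + 1)
          = borelCutoff (lam (N + i + 1)) h * ((h : ℝ) ^ 2) ^ i * ((h : ℝ) ^ 2 * M (N + i + 1)) *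
            ((h : ℝ) ^ 2) ^ N := by ring
        _ ≤ 1 * 1 * (1 / 2) ^ (N + i + 1) * ((h : ℝ) ^ 2) ^ N := by
            have := hM0 (N + i + 1)
            have := borelCutoff_nonneg (lam (N + i + 1)) h
            gcongr
            exact borelCutoff_le_one _ _
        _ = _ := by ring
  have hsmooth : ∀ (h : Ioc (0 : ℝ) 1) j, ContDiff ℝ ∞ (c j h) := fun h j => (hc j).contDiff h
  refine ⟨fun h => ?_, fun n => ?_⟩
  · refine ContDiff.sub ?_ (ContDiff.sum fun j _ => contDiff_const.mul (hsmooth h j))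
    exact ContDiff.sum fun j _ => contDiff_const.mul (hsmooth h j)
  -- From `m` on, `j` strictly exceeds `N`, and `k, n ≤ j`, so that `M j` controls the seminorm in
  -- question.
  set m := max N (max k n) + 1 with hm
  have hNm : N ≤ m := by omega
  -- the finitely many terms to which the tail estimate does not apply
  have hF : SchwartzO (fun h : Ioc (0 : ℝ) 1 => ((h : ℝ) ^ 2) ^ N) fun h w =>
      (∑ j ∈ Finset.range N,
        (((borelCutoff (lam j) h - 1) * ((h : ℝ) ^ 2) ^ j : ℝ) : ℂ) * c j h w) +
      ∑ j ∈ Finset.Ico N m, ((borelCutoff (lam j) h * ((h : ℝ) ^ 2) ^ j : ℝ) : ℂ) * c j h w := by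
    refine SchwartzO.add (SchwartzO.sum _ fun j _ => ?_) (SchwartzO.sum _ fun j hj => ?_)
    · refine ((hc j).const_mul (c := fun h : Ioc (0 : ℝ) 1 =>
        (((borelCutoff (lam j) h - 1) * ((h : ℝ) ^ 2) ^ j : ℝ) : ℂ))
        (η := fun h : Ioc (0 : ℝ) 1 => (lam j ^ 2) ^ N * ((h : ℝ) ^ 2) ^ N) fun h => ?_).mono
        (M := (lam j ^ 2) ^ N) (by positivity) fun h => by rw [one_mul]
      have h0 : (0 : ℝ) < h := h.2.1
      rw [Complex.norm_real, Real.norm_eq_abs, abs_mul]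
      have h1 : |((h : ℝ) ^ 2) ^ j| ≤ 1 := by
        rw [abs_of_nonneg (by positivity)]
        exact pow_le_one₀ (by positivity) (pow_le_one₀ h0.le h.2.2)
      have h2 := norm_borelCutoff_sub_one_le (lam := lam j) h0 N
      calc _ ≤ (lam j ^ 2) ^ N * ((h : ℝ) ^ 2) ^ N * 1 := by gcongr
        _ = _ := mul_one _
    · refine ((hc j).const_mul (c := fun h : Ioc (0 : ℝ) 1 =>
        ((borelCutoff (lam j) h * ((h : ℝ) ^ 2) ^ j : ℝ) : ℂ))
        (η := fun h : Ioc (0 : ℝ) 1 => ((h : ℝ) ^ 2) ^ N) fun h => ?_).mono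
        (M := 1) zero_le_one fun h => le_rfl
      have h0 : (0 : ℝ) < h := h.2.1
      rw [Complex.norm_real, Real.norm_eq_abs, abs_mul, abs_of_nonneg (borelCutoff_nonneg _ _),
        abs_of_nonneg (by positivity)]
      have h1 : ((h : ℝ) ^ 2) ^ j ≤ ((h : ℝ) ^ 2) ^ N :=
        pow_le_pow_of_le_one (by positivity) (pow_le_one₀ h0.le h.2.2) (Finset.mem_Ico.1 hj).1
      calc _ ≤ 1 * ((h : ℝ) ^ 2) ^ N := by
            gcongr
            exact borelCutoff_le_one _ _
        _ = _ := one_mul _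
  obtain ⟨C, hC0, hC⟩ := (hF k).2 n
  refine ⟨C + 2, by positivity, fun h w => ?_⟩
  have h0 : (0 : ℝ) < h := h.2.1
  set L := max m ⌈2 / (h : ℝ)⌉₊ with hL
  set F : PhaseSpace d → ℂ := fun w => (∑ j ∈ Finset.range N,
        (((borelCutoff (lam j) h - 1) * ((h : ℝ) ^ 2) ^ j : ℝ) : ℂ) * c j h w) +
      ∑ j ∈ Finset.Ico N m, ((borelCutoff (lam j) h * ((h : ℝ) ^ 2) ^ j : ℝ) : ℂ) * c j h w with hFdef
  set T : PhaseSpace d → ℂ := fun w => ∑ j ∈ Finset.Ico m L,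
    ((borelCutoff (lam j) h * ((h : ℝ) ^ 2) ^ j : ℝ) : ℂ) • c j h w with hTdef
  have hsplit : (fun w => borelSum lam c h w -
      ∑ j ∈ Finset.range N, (((h : ℝ) ^ 2 : ℝ) : ℂ) ^ j * c j h w) = F + T := by
    ext w
    rw [borelSum_eq hlam c h0 (le_max_right m _), Pi.add_apply,
      ← Finset.sum_range_add_sum_Ico _ (hNm.trans (le_max_left m ⌈2 / (h : ℝ)⌉₊)),
      ← Finset.sum_Ico_consecutive _ hNm (le_max_left m ⌈2 / (h : ℝ)⌉₊)]
    have e : ∑ j ∈ Finset.range N,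
        (((borelCutoff (lam j) h - 1) * ((h : ℝ) ^ 2) ^ j : ℝ) : ℂ) * c j h w =
        ∑ j ∈ Finset.range N, ((borelCutoff (lam j) h * ((h : ℝ) ^ 2) ^ j : ℝ) : ℂ) * c j h w -
        ∑ j ∈ Finset.range N, (((h : ℝ) ^ 2 : ℝ) : ℂ) ^ j * c j h w := by
      rw [← Finset.sum_sub_distrib]
      refine Finset.sum_congr rfl fun j _ => ?_
      push_cast
      ring
    simp only [hFdef, hTdef, e, smul_eq_mul, hL]
    ring
  have hTs : ContDiff ℝ ∞ T := ContDiff.sum fun j _ => (hsmooth h j).const_smul _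
  have hTb : ‖w‖ ^ k * ‖iteratedFDeriv ℝ n T w‖ ≤ 2 * ((h : ℝ) ^ 2) ^ N := by
    have e : iteratedFDeriv ℝ n T w = ∑ j ∈ Finset.Ico m L,
        ((borelCutoff (lam j) h * ((h : ℝ) ^ 2) ^ j : ℝ) : ℂ) • iteratedFDeriv ℝ n (c j h) w := by
      rw [hTdef, iteratedFDeriv_fun_sum_apply fun j _ =>
        (((hsmooth h j).const_smul _).of_le (mod_cast le_top)).contDiffAt]
      refine Finset.sum_congr rfl fun j _ => ?_
      exact iteratedFDeriv_const_smul_apply' ((hsmooth h j).of_le (mod_cast le_top)).contDiffAt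
    rw [e]
    calc _ ≤ ‖w‖ ^ k * ∑ j ∈ Finset.Ico m L, borelCutoff (lam j) h * ((h : ℝ) ^ 2) ^ j *
          ‖iteratedFDeriv ℝ n (c j h) w‖ := by
          gcongr
          refine (norm_sum_le _ _).trans (le_of_eq (Finset.sum_congr rfl fun j _ => ?_))
          rw [norm_smul, Complex.norm_real, Real.norm_of_nonneg
            (mul_nonneg (borelCutoff_nonneg _ _) (by positivity))]
      _ = ∑ j ∈ Finset.Ico m L, borelCutoff (lam j) h * ((h : ℝ) ^ 2) ^ j *
          (‖w‖ ^ k * ‖iteratedFDeriv ℝ n (c j h) w‖) := by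
          rw [Finset.mul_sum]
          exact Finset.sum_congr rfl fun j _ => by ring
      _ ≤ ∑ j ∈ Finset.Ico m L, (1 / 2) ^ j * ((h : ℝ) ^ 2) ^ N := by
          refine Finset.sum_le_sum fun j hj => ?_
          have hmj := (Finset.mem_Ico.1 hj).1
          refine le_trans ?_ (hterm j (by omega) h)
          exact mul_le_mul_of_nonneg_left (hM j k n (by omega) (by omega) h w)
            (mul_nonneg (borelCutoff_nonneg _ _) (by positivity))
      _ ≤ 2 * ((h : ℝ) ^ 2) ^ N := by
          rw [← Finset.sum_mul]
          gcongr
          refine (Summable.sum_le_tsum _ (fun j _ => by positivity)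
            summable_geometric_two).trans (le_of_eq tsum_geometric_two)
  change ‖w‖ ^ k * ‖iteratedFDeriv ℝ n (fun w => borelSum lam c h w -
    ∑ j ∈ Finset.range N, (((h : ℝ) ^ 2 : ℝ) : ℂ) ^ j * c j h w) w‖ ≤ (C + 2) * ((h : ℝ) ^ 2) ^ N
  rw [hsplit, iteratedFDeriv_add_apply (((hF.contDiff h).of_le (mod_cast le_top)).contDiffAt)
    ((hTs.of_le (mod_cast le_top)).contDiffAt)]
  calc _ ≤ ‖w‖ ^ k * (‖iteratedFDeriv ℝ n F w‖ + ‖iteratedFDeriv ℝ n T w‖) := by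
        gcongr; exact norm_add_le _ _
    _ ≤ _ := by
        have := hC h w
        linarith

end Parametrix

/-! ### Composition of asymptotic expansions -/

section Expansions

open scoped FourierTransform RealInnerProductSpace

variable {ι V : Type*} [NormedAddCommGroup V] [InnerProductSpace ℝ V] {τ : ι → ℝ}

/-- If `X` is asymptotic to `∑ τ ^ j T_j` and each `T_j` is asymptotic to `∑ τ ^ i m_{i,j}`, then
`X` is asymptotic to the series with the coefficients `∑_{i + j = n} m_{i,j}`. -/
lemma SchwartzO.of_double_expansion (hτ : ∀ i, 0 ≤ τ i) {X : ι → V → ℂ} {T : ℕ → ι → V → ℂ}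
    {m : ℕ → ℕ → ι → V → ℂ} (N : ℕ)
    (hX : SchwartzO (fun i => τ i ^ N) fun i w =>
      X i w - ∑ j ∈ Finset.range N, (τ i : ℂ) ^ j * T j i w)
    (hT : ∀ j L, SchwartzO (fun i => τ i ^ L) fun i w =>
      T j i w - ∑ k ∈ Finset.range L, (τ i : ℂ) ^ k * m k j i w) :
    SchwartzO (fun i => τ i ^ N) fun i w => X i w -
      ∑ n ∈ Finset.range N, (τ i : ℂ) ^ n * ∑ j ∈ Finset.range (n + 1), m (n - j) j i w := by
  -- Since `T j` carries the factor `τ ^ j`, expanding it to order `N - j` is enough.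
  have h := hX.add (SchwartzO.sum (Finset.range N) (F := fun j i w => (τ i : ℂ) ^ j *
    (T j i w - ∑ k ∈ Finset.range (N - j), (τ i : ℂ) ^ k * m k j i w)) fun j hj => by
      refine ((hT j (N - j)).const_mul (c := fun i => (τ i : ℂ) ^ j) (η := fun i => τ i ^ j)
        fun i => ?_).mono (M := 1) zero_le_one fun i => ?_
      · rw [norm_pow, Complex.norm_real, Real.norm_of_nonneg (hτ i)]
      · rw [one_mul, ← pow_add, Nat.sub_add_cancel (Finset.mem_range.1 hj).le])
  convert h using 3 with i w
  have key : ∑ n ∈ Finset.range N, (τ i : ℂ) ^ n * ∑ j ∈ Finset.range (n + 1), m (n - j) j i w =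
      ∑ j ∈ Finset.range N, (τ i : ℂ) ^ j *
        ∑ k ∈ Finset.range (N - j), (τ i : ℂ) ^ k * m k j i w := by
    simp_rw [Finset.mul_sum]
    rw [← Finset.sum_range_diag_flip N fun j k => (τ i : ℂ) ^ j * ((τ i : ℂ) ^ k * m k j i w)]
    refine Finset.sum_congr rfl fun n _ => Finset.sum_congr rfl fun j hj => ?_
    rw [← mul_assoc, ← pow_add, Nat.add_sub_cancel' (Nat.lt_succ_iff.1 (Finset.mem_range.1 hj))]
  rw [key]
  simp only [mul_sub, Finset.sum_sub_distrib]
  ring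

variable [FiniteDimensional ℝ V] [MeasurableSpace V] [BorelSpace V] (J : V →L[ℝ] V)

lemma isLinearMap_twist_left {Q : V → ℂ} (hQ : Continuous Q) {M : ℝ} (hM : ∀ w, ‖Q w‖ ≤ M)
    (τ : ℝ) (w : V) : IsLinearMap ℂ fun B : 𝓢(V, ℂ) => twist J τ B Q w where
  map_add B B' := by
    have h : 𝓕 ((B + B' : 𝓢(V, ℂ)) : V → ℂ) = 𝓕 (B : V → ℂ) + 𝓕 (B' : V → ℂ) := by
      simp only [← SchwartzMap.fourier_coe, FourierTransform.fourier_add]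
      rfl
    simp only [twist_eq_integral, h]
    rw [← integral_add (integrable_twistIntegrand J B hQ hM τ w)
      (integrable_twistIntegrand J B' hQ hM τ w)]
    congr 1 with ζ
    simp only [Pi.add_apply]
    ring
  map_smul c B := by
    have h : 𝓕 ((c • B : 𝓢(V, ℂ)) : V → ℂ) = c • 𝓕 (B : V → ℂ) := by
      simp only [← SchwartzMap.fourier_coe, FourierTransform.fourier_smul]
      rfl
    simp only [twist_eq_integral, h, smul_eq_mul]
    rw [← integral_const_mul]
    congr 1 with ζ
    simp only [Pi.smul_apply, smul_eq_mul]
    ring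

lemma isLinearMap_twist_right (B : 𝓢(V, ℂ)) (τ : ℝ) (w : V) :
    IsLinearMap ℂ fun Q : 𝓢(V, ℂ) => twist J τ B Q w where
  map_add Q Q' := by
    obtain ⟨M, hM⟩ := Q.exists_norm_le
    obtain ⟨M', hM'⟩ := Q'.exists_norm_le
    simp only [twist_eq_integral]
    rw [← integral_add (integrable_twistIntegrand J B Q.continuous hM τ w)
      (integrable_twistIntegrand J B Q'.continuous hM' τ w)]
    congr 1 with ζ
    simp only [add_apply]
    ring
  map_smul c Q := by
    simp only [twist_eq_integral, smul_eq_mul]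
    rw [← integral_const_mul]
    congr 1 with ζ
    simp only [smul_apply, smul_eq_mul]
    ring

omit [FiniteDimensional ℝ V] [MeasurableSpace V] [BorelSpace V] in
lemma IsLinearMap.map_sub_sum_schwartz {F : 𝓢(V, ℂ) → ℂ} (hF : IsLinearMap ℂ F)
    {X : ι → V → ℂ} {T : ℕ → ι → V → ℂ} {θ η : ι → ℝ} (hX : SchwartzO θ X)
    (hT : ∀ j, SchwartzO η (T j)) {s : Finset ℕ} {c : ℕ → ι → ℂ} {ρ : ι → ℝ}
    (hD : SchwartzO ρ fun i w => X i w - ∑ j ∈ s, c j i * T j i w) (i : ι) :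
    F (hD.toSchwartz i) = F (hX.toSchwartz i) - ∑ j ∈ s, c j i * F ((hT j).toSchwartz i) := by
  have h : hD.toSchwartz i = hX.toSchwartz i - ∑ j ∈ s, c j i • (hT j).toSchwartz i := by
    ext w
    simp [SchwartzO.coe_toSchwartz]
  rw [h]
  refine (_root_.map_sub (hF.mk' F) _ _).trans ?_
  rw [_root_.map_sum]
  simp only [_root_.map_smul]
  rfl

variable {B Q : ι → V → ℂ} {c : ℕ → ι → V → ℂ}

/-- By linearity in the left factor the expansion of `B` passes through `twist`; each resulting term
then has its own Moyal expansion, and the two series are merged. -/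
lemma SchwartzO.twist_expansion_left (hτ : ∀ i, τ i ∈ Icc (0 : ℝ) 1)
    (hB : SchwartzO (fun _ => 1) B) (hc : ∀ j, SchwartzO (fun _ => 1) (c j))
    (hBc : ∀ N : ℕ, SchwartzO (fun i => τ i ^ N) fun i w =>
      B i w - ∑ j ∈ Finset.range N, (τ i : ℂ) ^ j * c j i w)
    (hQ : SmoothO (fun _ => 1) Q) (N : ℕ) :
    SchwartzO (fun i => τ i ^ N) fun i w => twist J (τ i) (B i) (Q i) w -
      ∑ n ∈ Finset.range N, (τ i : ℂ) ^ n *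
        ∑ j ∈ Finset.range (n + 1), moyalTerm J (n - j) (c j i) (Q i) w := by
  refine SchwartzO.of_double_expansion (T := fun j i => twist J (τ i) (c j i) (Q i))
    (m := fun k j i => moyalTerm J k (c j i) (Q i)) (fun i => (hτ i).1) N ?_ fun j L => ?_
  · have h := (hBc N).twist J hQ hτ
    simp only [mul_one] at h
    convert h using 3 with i w
    obtain ⟨M, -, hM⟩ := hQ.norm_le
    exact ((isLinearMap_twist_left J (hQ.contDiff i).continuous (hM i) (τ i)
      w).map_sub_sum_schwartz hB hc (c := fun j i => (τ i : ℂ) ^ j) (hBc N) i).symm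
  · have h := (hc j).moyalRem J hQ L hτ
    simp only [mul_one] at h
    exact h

lemma SchwartzO.twist_expansion_right (hτ : ∀ i, τ i ∈ Icc (0 : ℝ) 1)
    (hB : SchwartzO (fun _ => 1) B) (hc : ∀ j, SchwartzO (fun _ => 1) (c j))
    (hQ : SchwartzO (fun _ => 1) Q) (hQc : ∀ N : ℕ, SchwartzO (fun i => τ i ^ N) fun i w =>
      Q i w - ∑ j ∈ Finset.range N, (τ i : ℂ) ^ j * c j i w) (N : ℕ) :
    SchwartzO (fun i => τ i ^ N) fun i w => twist J (τ i) (B i) (Q i) w -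
      ∑ n ∈ Finset.range N, (τ i : ℂ) ^ n *
        ∑ j ∈ Finset.range (n + 1), moyalTerm J (n - j) (B i) (c j i) w := by
  refine SchwartzO.of_double_expansion (T := fun j i => twist J (τ i) (B i) (c j i))
    (m := fun k j i => moyalTerm J k (B i) (c j i)) (fun i => (hτ i).1) N ?_ fun j L => ?_
  · have h := hB.twist J (hQc N).smoothO hτ
    simp only [one_mul] at h
    convert h using 3 with i w
    exact ((isLinearMap_twist_right J (hB.toSchwartz i) (τ i)
      w).map_sub_sum_schwartz hQ hc (c := fun j i => (τ i : ℂ) ^ j) (hQc N) i).symm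
  · have h := hB.moyalRem J (hc j).smoothO L hτ
    simp only [mul_one] at h
    exact h

end Expansions

/-! ### The coefficients of the parametrix -/

section Coefficients

open scoped Topology

variable {ι V : Type*} [NormedAddCommGroup V] [InnerProductSpace ℝ V]

lemma dirDeriv_eventuallyEq_zero {f : V → ℂ} {w : V} {z : ℂ} (hf : f =ᶠ[𝓝 w] fun _ => z) (v : V) :
    dirDeriv v f =ᶠ[𝓝 w] fun _ => 0 := by
  filter_upwards [hf.fderiv (𝕜 := ℝ)] with x hx
  simp [dirDeriv, hx]

variable [FiniteDimensional ℝ V] (J : V →L[ℝ] V)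

lemma moyalTerm_eq_zero_of_left (n : ℕ) {B Q : V → ℂ} {w : V} (hB : B =ᶠ[𝓝 w] fun _ => 0) :
    moyalTerm J n B Q w = 0 := by
  induction n generalizing B Q with
  | zero => simp [moyalTerm, hB.self_of_nhds]
  | succ n ih =>
    simp [moyalTerm, Finset.sum_eq_zero fun j _ => ih (dirDeriv_eventuallyEq_zero hB _)]

lemma moyalTerm_eq_zero_of_right (n : ℕ) {B Q : V → ℂ} {w : V} (hQ : Q =ᶠ[𝓝 w] fun _ => 0) :
    moyalTerm J n B Q w = 0 := by
  induction n generalizing B Q with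
  | zero => simp [moyalTerm, hQ.self_of_nhds]
  | succ n ih =>
    simp [moyalTerm, Finset.sum_eq_zero fun j _ => ih (dirDeriv_eventuallyEq_zero hQ _)]

/-- Positive-order Moyal terms differentiate the right factor and only see its germ at `w`; so they
vanish where it is locally constant. -/
lemma moyalTerm_succ_eq_zero_of_right (n : ℕ) {B Q : V → ℂ} {w : V} {z : ℂ}
    (hQ : Q =ᶠ[𝓝 w] fun _ => z) : moyalTerm J (n + 1) B Q w = 0 := by
  simp [moyalTerm, Finset.sum_eq_zero fun j _ =>
    moyalTerm_eq_zero_of_right J n (dirDeriv_eventuallyEq_zero hQ _)]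

/-- The coefficients of the symbol of a left parametrix of `A`, where `E` is a local inverse
of `A`. -/
noncomputable def parametrixCoeff (E A : V → ℂ) : ℕ → V → ℂ
  | 0 => E
  | n + 1 => fun w => -E w *
      ∑ j : Fin (n + 1), moyalTerm J (n + 1 - j) (parametrixCoeff E A j) A w

lemma parametrixCoeff_succ (E A : V → ℂ) (n : ℕ) (w : V) :
    parametrixCoeff J E A (n + 1) w = -E w *
      ∑ j ∈ Finset.range (n + 1), moyalTerm J (n + 1 - j) (parametrixCoeff J E A j) A w := by
  rw [parametrixCoeff]
  beta_reduce
  rw [Fin.sum_univ_eq_sum_range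
    fun j => moyalTerm J (n + 1 - j) (parametrixCoeff J E A j) A w]

/-- The recursion is solved for this: where `E A = 1`, the summand `j = n` is `c_n A`, which is
minus the sum of the preceding ones. -/
lemma sum_moyalTerm_parametrixCoeff {E A : V → ℂ} {w : V} (h : E w * A w = 1) (n : ℕ) :
    ∑ j ∈ Finset.range (n + 1), moyalTerm J (n - j) (parametrixCoeff J E A j) A w =
      if n = 0 then 1 else 0 := by
  cases n with
  | zero => simpa [moyalTerm, parametrixCoeff] using h
  | succ n =>
    rw [Finset.sum_range_succ, Nat.sub_self, moyalTerm, if_neg n.succ_ne_zero]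
    beta_reduce
    rw [parametrixCoeff_succ]
    linear_combination -(∑ j ∈ Finset.range (n + 1),
      moyalTerm J (n + 1 - j) (parametrixCoeff J E A j) A w) * h

lemma SchwartzO.parametrixCoeff {E A : ι → V → ℂ} (hE : SchwartzO (fun _ => 1) E)
    (hA : SmoothO (fun _ => 1) A) (n : ℕ) :
    SchwartzO (fun _ => 1) fun i => parametrixCoeff J (E i) (A i) n := by
  induction n using Nat.strong_induction_on with
  | _ n ih =>
    cases n with
    | zero => simpa only [_root_.parametrixCoeff] using hE
    | succ n =>
      have h : SchwartzO (fun _ => 1) fun i w => ∑ j ∈ Finset.range (n + 1),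
          moyalTerm J (n + 1 - j) (_root_.parametrixCoeff J (E i) (A i) j) (A i) w :=
        SchwartzO.sum _ fun j hj k => by
          simpa only [mul_one] using
            WeightedBound.moyalTerm J (n + 1 - j) (ih j (Finset.mem_range.1 hj) k) hA
      have h2 := (hE.mul h.smoothO).const_mul' (-1)
      simp only [mul_one] at h2
      convert h2 using 3 with i w
      rw [parametrixCoeff_succ]
      ring

lemma IsJointlySmooth.parametrixCoeff {d : ℕ} (J : PhaseSpace d →L[ℝ] PhaseSpace d)
    {E A : ℝ → PhaseSpace d → ℂ} (hE : IsJointlySmooth E) (hA : IsJointlySmooth A) (n : ℕ) :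
    IsJointlySmooth fun h => parametrixCoeff J (E h) (A h) n := by
  induction n using Nat.strong_induction_on with
  | _ n ih =>
    cases n with
    | zero => simpa only [_root_.parametrixCoeff] using hE
    | succ n =>
      have h : IsJointlySmooth fun h w => ∑ j ∈ Finset.range (n + 1),
          _root_.moyalTerm J (n + 1 - j) (_root_.parametrixCoeff J (E h) (A h) j) (A h) w :=
        IsJointlySmooth.sum _ fun j hj => (ih j (Finset.mem_range.1 hj)).moyalTerm J _ hA
      refine ((ContDiffOn.neg hE).mul h).congr fun q _ => ?_
      exact parametrixCoeff_succ J _ _ n q.2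

omit [FiniteDimensional ℝ V] in
/-- Composition with a smooth function preserves uniform bounds on all derivatives. -/
lemma SmoothO.comp_left {Q : ι → V → ℂ} (hQ : SmoothO (fun _ => 1) Q) {G : ℂ → ℂ}
    (hG : ContDiff ℝ ∞ G) : SmoothO (fun _ => 1) fun i w => G (Q i w) := by
  refine ⟨fun i => hG.comp (hQ.contDiff i), fun n => ?_⟩
  choose C hC0 hC using hQ.2
  -- All values of the family lie in one compact ball, on which each derivative of `G` is bounded.
  choose K hK using fun k : ℕ => (isCompact_closedBall (0 : ℂ) (C 0)).exists_bound_of_continuousOn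
    (hG.continuous_iteratedFDeriv (m := k) (mod_cast le_top)).continuousOn
  have hC' : ∀ k i w, ‖iteratedFDeriv ℝ k (Q i) w‖ ≤ C k := fun k i w => by
    simpa using hC k i w
  have hball : ∀ i w, Q i w ∈ Metric.closedBall (0 : ℂ) (C 0) := fun i w => by
    simpa using hC' 0 i w
  -- `D ≥ 1` dominates every `C k` with `k ≤ n`, hence `C k ≤ D ^ k` for `1 ≤ k ≤ n`, the form
  -- required by the composition estimate.
  set D := 1 + ∑ k ∈ Finset.range (n + 1), C k
  set L := ∑ k ∈ Finset.range (n + 1), |K k|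
  have hD1 : 1 ≤ D := le_add_of_nonneg_right (Finset.sum_nonneg fun k _ => hC0 k)
  have hL0 : 0 ≤ L := Finset.sum_nonneg fun k _ => abs_nonneg _
  refine ⟨n.factorial * L * D ^ n, by positivity, fun i w => ?_⟩
  rw [pow_zero, one_mul, mul_one]
  refine norm_iteratedFDeriv_comp_le (N := ∞) hG (hQ.contDiff i) (mod_cast le_top) w
    (fun k hk => ?_) fun k hk1 hk => ?_
  · exact ((hK k _ (hball i w)).trans (le_abs_self _)).trans
      (Finset.single_le_sum (f := fun k => |K k|) (fun k _ => abs_nonneg _)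
        (Finset.mem_range.2 (by omega)))
  · have h1 : C k ≤ D := (Finset.single_le_sum (f := C) (fun k _ => hC0 k)
      (Finset.mem_range.2 (by omega))).trans (le_add_of_nonneg_left zero_le_one)
    exact (hC' k i w).trans (h1.trans (le_self_pow₀ hD1 (by omega)))

/-- The function `z⁻¹`, smoothly modified near the origin. -/
lemma exists_contDiff_eq_inv {C : ℝ} (hC : 0 < C) :
    ∃ G : ℂ → ℂ, ContDiff ℝ ∞ G ∧ ∀ z, C ≤ ‖z‖ → G z = z⁻¹ := by
  let f : ContDiffBump (0 : ℂ) := ⟨C / 2, C, by linarith, by linarith⟩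
  refine ⟨fun z => (1 - (f z : ℂ)) * z⁻¹, contDiff_iff_contDiffAt.2 fun z => ?_, fun z hz => ?_⟩
  · rcases eq_or_ne z 0 with rfl | hz
    · refine (contDiffAt_const (c := (0 : ℂ))).congr_of_eventuallyEq ?_
      filter_upwards [f.eventuallyEq_one] with z hz
      simp [hz]
    · exact (contDiffAt_const.sub (Complex.ofRealCLM.contDiff.comp f.contDiff).contDiffAt).mul
        (contDiffAt_inv ℝ hz)
  · have h : f z = 0 := f.zero_of_le_dist (by simpa using hz)
    simp [h]

end Coefficients

/-! ### The microlocal left inverse -/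

section LeftInverse

open scoped Topology

variable {d : ℕ}

/-- If `c` is asymptotic to the series of the parametrix coefficients, then the iterated twisted
product of `b`, `c` and `A` differs from `b` by a rapidly decreasing remainder. -/
lemma SchwartzO.twist_twist_sub {V : Type*} [NormedAddCommGroup V] [InnerProductSpace ℝ V]
    [FiniteDimensional ℝ V] [MeasurableSpace V] [BorelSpace V] (J : V →L[ℝ] V) {ι : Type*}
    {τ : ι → ℝ} (hτ : ∀ i, τ i ∈ Icc (0 : ℝ) 1) {E A c : ι → V → ℂ}
    (hE : SchwartzO (fun _ => 1) E) (hA : SmoothO (fun _ => 1) A)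
    (hc : ∀ N : ℕ, SchwartzO (fun i => τ i ^ N) fun i w => c i w -
      ∑ j ∈ Finset.range N, (τ i : ℂ) ^ j * _root_.parametrixCoeff J (E i) (A i) j w)
    {O : Set V} (hO : IsOpen O) (hEA : ∀ i, ∀ w ∈ O, E i w * A i w = 1) (b : 𝓢(V, ℂ))
    (hb : tsupport b ⊆ O) (N : ℕ) :
    SchwartzO (fun i => τ i ^ N) fun i w =>
      _root_.twist J (τ i) b (_root_.twist J (τ i) (c i) (A i)) w - b w := by
  have hcoeff := hE.parametrixCoeff J hA
  have hc1 : SchwartzO (fun _ => 1) c := by simpa using hc 0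
  set q : ℕ → ι → V → ℂ := fun n i w => ∑ j ∈ Finset.range (n + 1),
    _root_.moyalTerm J (n - j) (_root_.parametrixCoeff J (E i) (A i) j) (A i) w with hqdef
  have hq : ∀ n, SchwartzO (fun _ => 1) (q n) := fun n => SchwartzO.sum _ fun j _ k => by
    simpa only [mul_one] using WeightedBound.moyalTerm J (n - j) (hcoeff j k) hA
  have hbS : SchwartzO (fun _ : ι => 1) fun _ => b := SchwartzMap.schwartzO b
  have hX : SchwartzO (fun _ => 1) fun i => _root_.twist J (τ i) (c i) (A i) := by
    simpa only [mul_one] using hc1.twist J hA hτ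
  -- On the open set `O` the coefficients of `c # A` are those of the constant `1`, and this holds
  -- near each point, so their derivatives vanish too.
  have hqO : ∀ n i, ∀ w ∈ O, q n i =ᶠ[𝓝 w] fun _ => if n = 0 then 1 else 0 := fun n i w hw => by
    filter_upwards [hO.mem_nhds hw] with x hx
    exact sum_moyalTerm_parametrixCoeff J (hEA i x hx) n
  have hb0 : ∀ w, w ∉ O → (b : V → ℂ) =ᶠ[𝓝 w] fun _ => 0 := fun w hw =>
    notMem_tsupport_iff_eventuallyEq.1 fun h => hw (hb h)
  -- On `O` only the pointwise product of `b` with `q n` survives; off `O` every term vanishes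
  -- because `b` is zero nearby.
  have hsum : ∀ n i w, ∑ j ∈ Finset.range (n + 1), _root_.moyalTerm J (n - j) b (q j i) w =
      if n = 0 then b w else 0 := fun n i w => by
    by_cases hw : w ∈ O
    · rw [Finset.sum_range_succ, Finset.sum_eq_zero fun j hj => ?_, zero_add, Nat.sub_self]
      · change b w * q n i w = _
        rw [(hqO n i w hw).self_of_nhds]
        split_ifs <;> simp
      · obtain ⟨k, hk⟩ := Nat.exists_eq_succ_of_ne_zero
          (Nat.sub_ne_zero_of_lt (Finset.mem_range.1 hj))
        rw [hk]
        exact moyalTerm_succ_eq_zero_of_right J k (hqO j i w hw)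
    · rw [Finset.sum_eq_zero fun j _ => moyalTerm_eq_zero_of_left J _ (hb0 w hw),
        (hb0 w hw).self_of_nhds, ite_self]
  have key := hbS.twist_expansion_right J hτ hq hX
    (hc1.twist_expansion_left J hτ hcoeff hc hA)
  simp only [hsum] at key
  -- For `N = 0` the expansion is an empty sum and does not contain `b`, so uniform boundedness is
  -- used; for `N + 1` the only surviving term is `b`.
  cases N with
  | zero =>
    have h := (hbS.twist J hX.smoothO hτ).sub (by simpa only [mul_one] using hbS)
    simpa only [mul_one, pow_zero] using h
  | succ N => simpa [Finset.sum_range_succ'] using key (N + 1)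

lemma exists_schwartz_dilate (f : 𝓢(PhaseSpace d, ℂ)) {h : ℝ} (hh : h ≠ 0) :
    ∃ g : 𝓢(PhaseSpace d, ℂ), (g : PhaseSpace d → ℂ) = fun z => f (h • z) :=
  ⟨SchwartzMap.compCLMOfContinuousLinearEquiv ℝ
    (ContinuousLinearEquiv.smulLeft (Units.mk0 h hh)) f, rfl⟩

lemma IsJointlySmooth.comp_smul {f : ℝ → PhaseSpace d → ℂ} (hf : IsJointlySmooth f) {g : ℝ → ℝ}
    (hg : ContDiffOn ℝ ∞ g (Ioc 0 1)) : IsJointlySmooth fun h z => f h (g h • z) := by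
  have h1 : ContDiffOn ℝ ∞ (fun q : ℝ × PhaseSpace d => g q.1) (Ioc (0 : ℝ) 1 ×ˢ univ) :=
    hg.comp contDiffOn_fst fun q hq => hq.1
  exact ContDiffOn.comp hf (contDiffOn_fst.prodMk (h1.smul contDiffOn_snd))
    fun q hq => ⟨hq.1, mem_univ _⟩

end LeftInverse

theorem lemmaA6 (d : ℕ) (a : ℝ → PhaseSpace d → ℂ) (ha : a ∈ hShubinClass d 0)
    (C R : ℝ) (hC : 0 < C) (hR : 0 < R)
    (hell : ∀ h ∈ Ioc (0 : ℝ) 1, ∀ z : PhaseSpace d, R ≤ h * ‖z‖ → C ≤ ‖a h z‖)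
    (U : Set (PhaseSpace d)) (hUc : IsCompact (closure U))
    (hUR : closure U ∩ Metric.closedBall (0 : PhaseSpace d) R = ∅) :
    ∃ c ∈ hShubinClass d 0,
      (IsJointlySmooth a → IsJointlySmooth c) ∧
      ∀ b : PhaseSpace d → ℂ, ContDiff ℝ ∞ b → HasCompactSupport b → tsupport b ⊆ U →
        ∃ p s : ℝ → PhaseSpace d → ℂ,
          (∀ h ∈ Ioc (0 : ℝ) 1, IsWeylProduct (dilate b h) (c h) (p h)) ∧
          (∀ h ∈ Ioc (0 : ℝ) 1, IsWeylProduct (p h) (a h) (s h)) ∧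
          (fun h z => s h z - dilate b h z) ∈ hNegligible d := by
  set J := symplecticMap d
  obtain ⟨R', hR'0, hUR'⟩ : ∃ R', 0 < R' ∧ closure U ⊆ Metric.ball 0 R' := by
    obtain ⟨r, hr⟩ := hUc.isBounded.subset_ball (0 : PhaseSpace d)
    exact ⟨max r 1, by positivity, hr.trans (Metric.ball_subset_ball (le_max_left _ _))⟩
  -- The cutoff only serves to make `E` Schwartz. It need not vanish near the ball of radius `R`,
  -- since `G` is smooth everywhere; there `E` is merely not an inverse of `A`.
  let χ : ContDiffBump (0 : PhaseSpace d) := ⟨R', R' + 1, hR'0, by linarith⟩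
  let χS : 𝓢(PhaseSpace d, ℂ) := (χ.hasCompactSupport.comp_left
    (g := ((↑) : ℝ → ℂ)) Complex.ofReal_zero).toSchwartzMap
      (Complex.ofRealCLM.contDiff.comp χ.contDiff)
  obtain ⟨G, hG, hGinv⟩ := exists_contDiff_eq_inv hC
  set A : ℝ → PhaseSpace d → ℂ := fun h w => a h (h⁻¹ • w)
  have hA : SmoothO (fun _ : Ioc (0 : ℝ) 1 => 1) fun h => A h := smoothO_of_mem_hShubinClass ha
  set E : ℝ → PhaseSpace d → ℂ := fun h w => χS w * G (A h w)
  have hE : SchwartzO (fun _ : Ioc (0 : ℝ) 1 => 1) fun h => E h := by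
    simpa only [mul_one] using (SchwartzMap.schwartzO χS).mul (hA.comp_left hG)
  set O : Set (PhaseSpace d) := Metric.ball 0 R' \ Metric.closedBall 0 R
  have hO : IsOpen O := Metric.isOpen_ball.sdiff Metric.isClosed_closedBall
  have hUO : U ⊆ O := fun w hw => ⟨hUR' (subset_closure hw), fun h =>
    (hUR ▸ (⟨subset_closure hw, h⟩ : w ∈ closure U ∩ Metric.closedBall 0 R) : w ∈ (∅ : Set _))⟩
  have hEA : ∀ h : Ioc (0 : ℝ) 1, ∀ w ∈ O, E h w * A h w = 1 := fun h w hw => by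
    have h0 : (0 : ℝ) < h := h.2.1
    have h1 : χS w = 1 := by
      change ((χ w : ℝ) : ℂ) = 1
      rw [χ.one_of_mem_closedBall (Metric.ball_subset_closedBall hw.1), Complex.ofReal_one]
    have h2 : C ≤ ‖A h w‖ := by
      refine hell h h.2 _ ?_
      rw [norm_smul, Real.norm_of_nonneg (by positivity), mul_inv_cancel_left₀ h0.ne']
      have h3 := hw.2
      rw [mem_closedBall_zero_iff, not_le] at h3
      exact h3.le
    have h3 : A h w ≠ 0 := norm_pos_iff.1 (hC.trans_le h2)
    simp only [E, h1, hGinv _ h2, one_mul]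
    exact inv_mul_cancel₀ h3
  obtain ⟨lam, hlam, hc⟩ := exists_borelSum
    (c := fun j h => parametrixCoeff J (E h) (A h) j) fun j => hE.parametrixCoeff J hA j
  set c : ℝ → PhaseSpace d → ℂ := borelSum lam fun j h => parametrixCoeff J (E h) (A h) j
  have hcS : SchwartzO (fun _ : Ioc (0 : ℝ) 1 => 1) fun h => c h := by simpa using hc 0
  refine ⟨fun h z => c h (h • z), hcS.dilate_mem_hShubinClass 0, fun hja => ?_,
    fun b hb hbc hbU => ?_⟩
  · have hjA : IsJointlySmooth A := hja.comp_smul (contDiffOn_id.inv fun h hh => hh.1.ne')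
    have hjE : IsJointlySmooth E := (isJointlySmooth_const_right (χS.smooth ⊤)).mul
      (hG.comp_contDiffOn hjA)
    exact (isJointlySmooth_borelSum hlam fun j => hjE.parametrixCoeff J hjA j).comp_smul
      contDiffOn_id
  let bS : 𝓢(PhaseSpace d, ℂ) := hbc.toSchwartzMap hb
  have hbS : (bS : PhaseSpace d → ℂ) = b := rfl
  have hτ : ∀ h : Ioc (0 : ℝ) 1, (h : ℝ) ^ 2 ∈ Icc (0 : ℝ) 1 := fun h =>
    ⟨by positivity, pow_le_one₀ h.2.1.le h.2.2⟩
  have hdil : ∀ h ∈ Ioc (0 : ℝ) 1, ∃ B D : 𝓢(PhaseSpace d, ℂ), (B : PhaseSpace d → ℂ) = dilate b h ∧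
      (D : PhaseSpace d → ℂ) = (fun z => c h (h • z)) ∧
      SmoothO (fun _ : Unit => 1) fun _ => a h := fun h hh => by
    obtain ⟨B, hB⟩ := exists_schwartz_dilate bS hh.1.ne'
    obtain ⟨D, hD⟩ := exists_schwartz_dilate (hcS.toSchwartz ⟨h, hh⟩) hh.1.ne'
    refine ⟨B, D, hB, hD, ?_⟩
    -- For fixed `h`, boundedness of the derivatives of `a h` is recovered by composing `A h` with
    -- `z ↦ h z`.
    have := (hA.comp_index fun _ : Unit => ⟨h, hh⟩).comp_affine (fun _ => 0)
      (fun _ => h • .id ℝ (PhaseSpace d)) fun _ => le_rfl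
    simpa [A, smul_smul, inv_mul_cancel₀ hh.1.ne'] using this
  -- Both products are computed in the variable `w` with parameter `h²` and then dilated; the second
  -- is bracketed as `b # (c # A)`, the form whose expansion is known.
  refine ⟨fun h z => twist J (h ^ 2) b (c h) (h • z),
    fun h z => twist J (h ^ 2) b (twist J (h ^ 2) (c h) (A h)) (h • z), fun h hh => ?_,
    fun h hh => ?_, ?_⟩
  · obtain ⟨B, D, hB, hD, -⟩ := hdil h hh
    have h1 := isWeylProduct_twist B D.smoothO
    rw [hB, hD] at h1
    convert h1 using 1
    ext z
    exact (twist_comp_smul J hh.1 b (c h) z).symm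
  · obtain ⟨B, D, hB, hD, haS⟩ := hdil h hh
    have h1 := isWeylProduct_twist_twist B D haS
    rw [hB, hD] at h1
    have h2 : a h = fun z => A h (h • z) := by
      ext z
      simp only [A, smul_smul, inv_mul_cancel₀ hh.1.ne', one_smul]
    have h3 : twist J 1 (fun z => c h (h • z)) (a h) =
        fun z => twist J (h ^ 2) (c h) (A h) (h • z) := by
      ext z
      rw [h2, twist_comp_smul J hh.1]
    convert h1 using 1
    · ext z
      exact (twist_comp_smul J hh.1 b (c h) z).symm
    · ext z
      rw [h3]
      exact (twist_comp_smul J hh.1 b _ z).symm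
  · refine dilate_mem_hNegligible (R := fun h w =>
      twist J (h ^ 2) b (twist J (h ^ 2) (c h) (A h)) w - b w) fun N => ?_
    exact SchwartzO.twist_twist_sub J hτ hE hA hc hO hEA bS (hbU.trans hUO) N
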